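/- All digraphs are finite and simple (no loops, no multiple arcs; two opposite arcs are allowed). For a digraph $D$ with adjacency matrix $A$, a real number $\lambda$ is a \emph{complementarity eigenvalue} of $D$ if there is a nonzero, entrywise nonnegative vector $x$ with $Ax\ge\lambda x$ entrywise and $\langle x, Ax-\lambda x\rangle=0$. Subdigraphs need not be induced, and types of digraphs are understood up to isomorphism. $\vec C_n$ denotes the directed cycle $1\to2\to\cdots\to n\to1$. An \emph{$\infty$-digraph} consists of two directed cycles (each with at least two vertices) that share exactly one vertex. A \emph{$\theta$-digraph} $\theta(a,b,c)$, with $0\le a\le b$, $b>0$, $c\ge0$, consists of two directed paths from a vertex $w$ to a vertex $v\neq w$, with $a$ and $b$ inner vertices, and a directed path from $v$ to $w$ with $c$ inner vertices, where no two of the three paths have a common inner vertex. A \emph{Type 3 digraph} is $\vec C_n\cup\{(1,i),(i-1,j)\}$ with $2<i<j\le n$. A \emph{Type 4 digraph} is $\vec C_n\cup\{(x_1,y_1),\dots,(x_k,y_k)\}$ with $k\ge2$ and $1\le y_1<x_1<y_2<x_2<\cdots<y_k<x_k\le n$. A \emph{Type 5 digraph} is $\vec C_n\cup\{(1,i),(i-1,j),(j-1,2)\}$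 with $3<i<i+1<j\le n$. \textbf{Theorem.} Let $D$ be a strongly connected digraph with exactly three complementarity eigenvalues that contains a $\theta$-digraph but no $\infty$-digraph as a subdigraph. Then $D$ is a $\theta$-digraph, a Type 3 digraph, a Type 4 digraph or a Type 5 digraph. -/

import Mathlib

/-! Complementarity spectrum of a matrix -/

/-- The complementarity eigenvalues of a real square matrix `A`: the reals `t` for which some
nonzero, entrywise nonnegative vector `x` satisfies `A x ≥ t x` and `⟨x, A x - t x⟩ = 0`. -/
def Matrix.complementaritySpectrum {V : Type*} [Fintype V] (A : Matrix V V ℝ) : Set ℝ :=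
  {t : ℝ | ∃ x : V → ℝ, x ≠ 0 ∧ (∀ i, 0 ≤ x i) ∧ (∀ i, t * x i ≤ (A.mulVec x) i) ∧
    x ⬝ᵥ (A.mulVec x - t • x) = 0}

namespace Digraph

open Classical in
/-- The 0-1 adjacency matrix of a digraph. -/
noncomputable def adjMatrix {V : Type*} (D : Digraph V) : Matrix V V ℝ :=
  Matrix.of fun x y => if D.Adj x y then 1 else 0

/-- The complementarity spectrum of a digraph. -/
noncomputable def complementaritySpectrum {V : Type*} [Fintype V] (D : Digraph V) : Set ℝ :=
  D.adjMatrix.complementaritySpectrum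

/-- A digraph in the sense of `Digraph` never has multiple arcs; it is simple if it has no loops.
Two opposite arcs between two vertices are allowed. -/
def IsSimple {V : Type*} (D : Digraph V) : Prop :=
  ∀ x, ¬ D.Adj x x

/-- Every vertex can be reached from every vertex by a directed walk. -/
def StronglyConnected {V : Type*} (D : Digraph V) : Prop :=
  ∀ x y, Relation.ReflTransGen D.Adj x y

/-- `(x, y)` is one of the arcs `(p 0, p 1), (p 1, p 2), …` of the path `p`. -/
def IsPathArc {V : Type*} {m : ℕ} (p : Fin m → V) (x y : V) : Prop :=
  ∃ i j : Fin m, (j : ℕ) = i + 1 ∧ p i = x ∧ p j = y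

/-- `(x, y)` is one of the arcs `(p 0, p 1), …, (p (m - 1), p 0)` of the cycle `p`. -/
def IsCycleArc {V : Type*} {m : ℕ} (p : Fin m → V) (x y : V) : Prop :=
  ∃ i j : Fin m, (j : ℕ) = (i + 1) % m ∧ p i = x ∧ p j = y

/-- `D` is the coalescence `∞(r, s)` of a directed cycle on `r` vertices and a directed cycle
on `s` vertices: they share exactly one vertex, and `D` has no other vertices or arcs. -/
def IsInfinityDigraph {V : Type*} (D : Digraph V) : Prop :=
  ∃ (r s : ℕ) (hr : 2 ≤ r) (hs : 2 ≤ s) (p : Fin r → V) (q : Fin s → V),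
    Function.Injective p ∧ Function.Injective q ∧
    (∀ i j, p i = q j ↔ i = ⟨0, by omega⟩ ∧ j = ⟨0, by omega⟩) ∧
    (∀ x, x ∈ Set.range p ∪ Set.range q) ∧
    (∀ x y, D.Adj x y ↔ IsCycleArc p x y ∨ IsCycleArc q x y)

/-- `D` is a digraph `θ(a, b, c)` with `a ≤ b` and `0 < b`: it consists of directed paths `p`
and `q` from `w` to `v`, with `a` and `b` inner vertices, and a directed path `r` from `v` to `w`
with `c` inner vertices; these paths have no common vertices besides `v` and `w`. -/
def IsThetaDigraph {V : Type*} (D : Digraph V) : Prop :=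
  ∃ (a b c : ℕ) (p : Fin (a + 2) → V) (q : Fin (b + 2) → V) (r : Fin (c + 2) → V),
    a ≤ b ∧ 0 < b ∧
    Function.Injective p ∧ Function.Injective q ∧ Function.Injective r ∧
    (∀ i j, p i = q j ↔ (i = 0 ∧ j = 0) ∨ (i = Fin.last _ ∧ j = Fin.last _)) ∧
    (∀ i j, p i = r j ↔ (i = 0 ∧ j = Fin.last _) ∨ (i = Fin.last _ ∧ j = 0)) ∧
    (∀ i j, q i = r j ↔ (i = 0 ∧ j = Fin.last _) ∨ (i = Fin.last _ ∧ j = 0)) ∧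
    (∀ x, x ∈ Set.range p ∪ Set.range q ∪ Set.range r) ∧
    (∀ x y, D.Adj x y ↔ IsPathArc p x y ∨ IsPathArc q x y ∨ IsPathArc r x y)

/-- `H`, with vertex set `s`, is a (not necessarily induced) subdigraph of `D`. -/
def IsSubdigraph {V : Type*} {s : Set V} (H : Digraph s) (D : Digraph V) : Prop :=
  ∀ x y : s, H.Adj x y → D.Adj x y

/-- Some subdigraph of `D` is an ∞-digraph. -/
def HasInfinitySubdigraph {V : Type*} (D : Digraph V) : Prop :=
  ∃ (s : Set V) (H : Digraph s), H.IsSubdigraph D ∧ H.IsInfinityDigraph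

/-- Some subdigraph of `D` is a θ-digraph. -/
def HasThetaSubdigraph {V : Type*} (D : Digraph V) : Prop :=
  ∃ (s : Set V) (H : Digraph s), H.IsSubdigraph D ∧ H.IsThetaDigraph

/-- The directed cycle `1 → 2 → ⋯ → n → 1` together with the arcs in `E`, which are given by
labels in `{1, …, n}`; the vertex `x : Fin n` carries the label `x + 1`. -/
def cycleWithArcs (n : ℕ) (E : Set (ℕ × ℕ)) : Digraph (Fin n) where
  Adj x y := (y : ℕ) = (x + 1) % n ∨ ((x : ℕ) + 1, (y : ℕ) + 1) ∈ E

/-- Isomorphism of digraphs. -/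
def Isomorphic {V W : Type*} (D : Digraph V) (H : Digraph W) : Prop :=
  Nonempty (D.Adj ≃r H.Adj)

/-- Type 3: a directed `n`-cycle with the arcs `(1, i)` and `(i - 1, j)`. -/
def IsType3 {V : Type*} (D : Digraph V) : Prop :=
  ∃ n i j : ℕ, 2 < i ∧ i < j ∧ j ≤ n ∧
    D.Isomorphic (cycleWithArcs n {(1, i), (i - 1, j)})

/-- Type 4: a directed `n`-cycle with `k ≥ 2` arcs `(x₁, y₁), …, (x_k, y_k)`, where
`1 ≤ y₁ < x₁ < y₂ < x₂ < ⋯ < y_k < x_k ≤ n`. -/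
def IsType4 {V : Type*} (D : Digraph V) : Prop :=
  ∃ (n k : ℕ) (x y : ℕ → ℕ), 2 ≤ k ∧ 1 ≤ y 1 ∧ x k ≤ n ∧
    (∀ i ∈ Finset.Icc 1 k, y i < x i) ∧
    (∀ i ∈ Finset.Ico 1 k, x i < y (i + 1)) ∧
    D.Isomorphic (cycleWithArcs n {e | ∃ i ∈ Finset.Icc 1 k, e = (x i, y i)})

/-- Type 5: a directed `n`-cycle with the arcs `(1, i)`, `(i - 1, j)` and `(j - 1, 2)`. -/
def IsType5 {V : Type*} (D : Digraph V) : Prop :=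
  ∃ n i j : ℕ, 3 < i ∧ i + 1 < j ∧ j ≤ n ∧
    D.Isomorphic (cycleWithArcs n {(1, i), (i - 1, j), (j - 1, 2)})

end Digraph

/-! The spectral radius of every strongly connected induced subdigraph is a complementarity
eigenvalue. A single vertex contributes 0, an induced cycle contributes 1, and `D` contributes its
own radius. By Perron–Frobenius, a proper strongly connected induced subdigraph in which some vertex
has two out-neighbours has radius strictly between 1 and that of `D`, which would be a fourth
eigenvalue. So `D` is critical: a strongly connected vertex set in which some vertex branches is the
whole vertex set (`StrongOn.eq_univ_of_ncard_eq_three`).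

The rest is combinatorial. A shortest closed walk `c` is a chordless cycle. The θ-subdigraph yields
a branching vertex, so `c` is not spanning, and by criticality a shortest ear `p` of `c` covers all
remaining vertices (`exists_isEar`). Minimality leaves few possible arcs besides those of `c` and
`p`: arcs from `c` to the first ear vertex (starts), arcs from the last ear vertex to `c` (ends),
and backward arcs inside the ear.

The ear and the stretch of `c` from an end to a start form a closed walk. If a vertex branches
inside it, then the stretch must exhaust the cycle (`IsEar.critical`); this fixes the positions of
all starts and ends. One start, one end and no backward arc give a θ-digraph; backward arcs give
Type 4; two starts or two ends give Type 3; two of each give Type 5. The absence of ∞-digraphs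
separates starts from ends and rules out an ear with one vertex in the last case. -/

/-! ### Perron–Frobenius theory by the Collatz–Wielandt maximum -/

namespace Matrix

/-- `y` is a nonzero nonnegative vector supported in `S` with `B y ≥ t y`. -/
def IsSubeigenvector {V : Type*} [Fintype V] (B : Matrix V V ℝ) (S : Set V) (t : ℝ)
    (y : V → ℝ) : Prop :=
  (∀ i, 0 ≤ y i) ∧ y ≠ 0 ∧ (∀ i, i ∉ S → y i = 0) ∧ ∀ i, t * y i ≤ (B.mulVec y) i

variable {V : Type*} [Fintype V]

theorem mulVec_nonneg_of_nonneg {B : Matrix V V ℝ} (hB : ∀ i j, 0 ≤ B i j) {y : V → ℝ}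
    (hy : ∀ i, 0 ≤ y i) (i : V) : 0 ≤ (B.mulVec y) i :=
  Finset.sum_nonneg fun j _ => mul_nonneg (hB i j) (hy j)

theorem mulVec_pos_of_pos {B : Matrix V V ℝ} (hB : ∀ i j, 0 ≤ B i j) {y : V → ℝ}
    (hy : ∀ i, 0 ≤ y i) {i j : V} (hij : 0 < B i j) (hj : 0 < y j) : 0 < (B.mulVec y) i :=
  lt_of_lt_of_le (mul_pos hij hj)
    (Finset.single_le_sum (f := fun j => B i j * y j)
      (fun j _ => mul_nonneg (hB i j) (hy j)) (Finset.mem_univ j))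

/-- The Collatz–Wielandt maximum is attained. -/
theorem exists_max_isSubeigenvector (B : Matrix V V ℝ) (S : Set V) (hS : S.Nonempty)
    (hB : ∀ i j, 0 ≤ B i j) :
    ∃ m x, B.IsSubeigenvector S m x ∧ ∀ t y, B.IsSubeigenvector S t y → t ≤ m := by
  classical
  obtain ⟨v, hv⟩ := hS
  -- Summing `t * y i ≤ (B y) i` over `i` shows that no admissible `t` exceeds the sum of all
  -- entries. After normalising `y`, the pairs `(t, y)` with `0 ≤ t` thus form a compact set, on
  -- which `t` is maximised jointly with `y`.
  set b : ℝ := ∑ i, ∑ j, B i j with hb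
  let Z : Set (ℝ × (V → ℝ)) := {p | p ∈ Set.Icc 0 b ×ˢ stdSimplex ℝ V ∧
    (∀ i, i ∉ S → p.2 i = 0) ∧ ∀ i, p.1 * p.2 i ≤ (B.mulVec p.2) i}
  have hb0 : 0 ≤ b := Finset.sum_nonneg fun i _ => Finset.sum_nonneg fun j _ => hB i j
  have hZc : IsCompact Z := by
    refine (isCompact_Icc.prod (isCompact_stdSimplex ℝ V)).of_isClosed_subset ?_ fun p hp => hp.1
    have h0 : IsClosed (Set.Icc 0 b ×ˢ stdSimplex ℝ V) :=
      (isCompact_Icc.prod (isCompact_stdSimplex ℝ V)).isClosed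
    have h1 : IsClosed {p : ℝ × (V → ℝ) | ∀ i, i ∉ S → p.2 i = 0} := by
      have : {p : ℝ × (V → ℝ) | ∀ i, i ∉ S → p.2 i = 0} =
          ⋂ i, ⋂ (_ : i ∉ S), {p : ℝ × (V → ℝ) | p.2 i = 0} := by ext; simp
      rw [this]
      exact isClosed_iInter fun i => isClosed_iInter fun _ =>
        isClosed_eq (by fun_prop) continuous_const
    have h2 : IsClosed {p : ℝ × (V → ℝ) | ∀ i, p.1 * p.2 i ≤ (B.mulVec p.2) i} := by
      have : {p : ℝ × (V → ℝ) | ∀ i, p.1 * p.2 i ≤ (B.mulVec p.2) i} =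
          ⋂ i, {p : ℝ × (V → ℝ) | p.1 * p.2 i ≤ (B.mulVec p.2) i} := by ext; simp
      rw [this]
      refine isClosed_iInter fun i => isClosed_le (by fun_prop) ?_
      simp only [mulVec, dotProduct]
      fun_prop
    exact h0.inter (h1.inter h2)
  have hZn : Z.Nonempty := by
    refine ⟨(0, Pi.single v 1), ⟨⟨⟨le_rfl, hb0⟩, single_mem_stdSimplex ℝ v⟩, ?_, ?_⟩⟩
    · intro i hi
      exact Pi.single_eq_of_ne (fun h : i = v => hi (h ▸ hv)) _
    · intro i
      simp only [zero_mul]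
      refine mulVec_nonneg_of_nonneg hB (fun j => ?_) i
      by_cases h : j = v
      · subst h; simp
      · simp [h]
  obtain ⟨⟨m, x⟩, hx, hmax⟩ := hZc.exists_isMaxOn hZn continuous_fst.continuousOn
  refine ⟨m, x, ⟨hx.1.2.1, ?_, hx.2.1, hx.2.2⟩, ?_⟩
  · rintro rfl
    have := hx.1.2.2
    simp at this
  · rintro t y ⟨hy0, hyne, hyS, hy⟩
    by_cases ht : t < 0
    · exact ht.le.trans hx.1.1.1
    push Not at ht
    set c : ℝ := ∑ i, y i with hc
    have hcpos : 0 < c := by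
      obtain ⟨i, hi⟩ := Function.ne_iff.1 hyne
      exact Finset.sum_pos' (fun i _ => hy0 i)
        ⟨i, Finset.mem_univ i, lt_of_le_of_ne (hy0 i) (Ne.symm hi)⟩
    have htb : t ≤ b := by
      have h1 : t * c ≤ b * c := by
        calc t * c = ∑ i, t * y i := by rw [hc, Finset.mul_sum]
          _ ≤ ∑ i, ∑ j, B i j * y j := Finset.sum_le_sum fun i _ => hy i
          _ ≤ ∑ i, ∑ j, B i j * c := by
            refine Finset.sum_le_sum fun i _ => Finset.sum_le_sum fun j _ => ?_
            exact mul_le_mul_of_nonneg_left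
              (Finset.single_le_sum (fun i _ => hy0 i) (Finset.mem_univ j)) (hB i j)
          _ = b * c := by simp only [hb, Finset.sum_mul]
      exact le_of_mul_le_mul_right h1 hcpos
    have : (t, c⁻¹ • y) ∈ Z := by
      refine ⟨⟨⟨ht, htb⟩, fun i => ?_, ?_⟩, fun i hi => ?_, fun i => ?_⟩
      · exact mul_nonneg (inv_nonneg.2 hcpos.le) (hy0 i)
      · simp only [Pi.smul_apply, smul_eq_mul, ← Finset.mul_sum]
        exact inv_mul_cancel₀ hcpos.ne'
      · simp [hyS i hi]
      · simp only [mulVec_smul, Pi.smul_apply, smul_eq_mul]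
        have := mul_le_mul_of_nonneg_left (hy i) (inv_nonneg.2 hcpos.le)
        linarith
    exact hmax this

/-- If `B` is irreducible on `S`, then the Collatz–Wielandt maximum is only attained by eigenvectors
that are positive on `S`. -/
theorem IsSubeigenvector.eq_of_isMax {B : Matrix V V ℝ} {S : Set V} (hB : ∀ i j, 0 ≤ B i j)
    (hBS : ∀ i j, 0 < B i j → i ∈ S)
    (hconn : ∀ i ∈ S, ∀ j ∈ S, Relation.ReflTransGen (fun a b => 0 < B a b) i j)
    {m : ℝ} (hmax : ∀ t y, B.IsSubeigenvector S t y → t ≤ m) {x : V → ℝ}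
    (hx : B.IsSubeigenvector S m x) : (∀ i, (B.mulVec x) i = m * x i) ∧ ∀ i ∈ S, 0 < x i := by
  classical
  have hB0 : ∀ i, i ∉ S → ∀ y, (B.mulVec y) i = 0 := by
    intro i hi y
    refine Finset.sum_eq_zero fun j _ => ?_
    have : B i j = 0 := by
      by_contra h
      exact hi (hBS i j (lt_of_le_of_ne (hB i j) (Ne.symm h)))
    simp [this]
  -- If some maximiser is not an eigenvector, choose one, `y`, with as many strict rows as possible.
  -- The residual of `y + B y` is `z + B z`, where `z` is that of `y`: strict rows stay strict, and
  -- so becomes every row with a positive entry in a strict column. By maximality no row is new, so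
  -- irreducibility makes all rows in `S` strict, and `m` could be raised.
  have key : ∀ y, B.IsSubeigenvector S m y → ∀ i, (B.mulVec y) i = m * y i := by
    let T : (V → ℝ) → Finset V := fun y => Finset.univ.filter fun i => m * y i < (B.mulVec y) i
    by_contra hcon
    push Not at hcon
    obtain ⟨y₀, hy₀, i₀, hi₀⟩ := hcon
    let N : Set ℕ := {k | ∃ y, B.IsSubeigenvector S m y ∧ (T y).Nonempty ∧ (T y).card = k}
    have hNne : N.Nonempty :=
      ⟨_, y₀, hy₀, ⟨i₀, by simpa [T] using lt_of_le_of_ne (hy₀.2.2.2 i₀) (Ne.symm hi₀)⟩, rfl⟩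
    have hNb : BddAbove N := ⟨Fintype.card V, by rintro _ ⟨y, -, -, rfl⟩; exact Finset.card_le_univ _⟩
    obtain ⟨y, hy, ⟨j₀, hj₀⟩, hcard⟩ := Nat.sSup_mem hNne hNb
    have hTS : ∀ i ∈ T y, i ∈ S := by
      intro i hi
      by_contra h
      have : m * y i < (B.mulVec y) i := by simpa [T] using hi
      rw [hB0 i h, hy.2.2.1 i h] at this
      simp at this
    let z : V → ℝ := fun i => (B.mulVec y) i - m * y i
    have hz : ∀ i, 0 ≤ z i := fun i => sub_nonneg.2 (hy.2.2.2 i)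
    let y' : V → ℝ := y + B.mulVec y
    have hBy := mulVec_nonneg_of_nonneg hB hy.1
    have hdiff : ∀ i, (B.mulVec y') i - m * y' i = z i + (B.mulVec z) i := by
      intro i
      have : z = B.mulVec y - m • y := by ext; simp [z]
      rw [this, mulVec_sub, mulVec_smul]
      simp only [y', mulVec_add, Pi.add_apply, Pi.sub_apply, Pi.smul_apply, smul_eq_mul]
      ring
    have hBz := mulVec_nonneg_of_nonneg hB hz
    have hy' : B.IsSubeigenvector S m y' := by
      refine ⟨fun i => add_nonneg (hy.1 i) (hBy i), ?_, ?_, ?_⟩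
      · intro h
        refine hy.2.1 (funext fun i => ?_)
        have h1 : y i + (B.mulVec y) i = 0 := congrFun h i
        have := hy.1 i
        have := hBy i
        simp only [Pi.zero_apply]
        linarith
      · intro i hi
        simp [y', hB0 i hi, hy.2.2.1 i hi]
      · intro i
        have := hdiff i
        have := hz i
        have := hBz i
        linarith
    have hsub : T y ⊆ T y' := by
      intro i hi
      have h1 : m * y i < (B.mulVec y) i := by simpa [T] using hi
      have h2 := hdiff i
      have h3 := hBz i
      simp only [T, Finset.mem_filter, Finset.mem_univ, true_and]
      simp only [z] at h2
      linarith
    have heq : T y = T y' := by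
      refine Finset.eq_of_subset_of_card_le hsub ?_
      rw [hcard]
      exact le_csSup hNb ⟨y', hy', ⟨j₀, hsub hj₀⟩, rfl⟩
    have hclosed : ∀ i j, 0 < B i j → j ∈ T y → i ∈ T y := by
      intro i j hij hj
      rw [heq]
      have h1 : m * y j < (B.mulVec y) j := by simpa [T] using hj
      have h2 := mulVec_pos_of_pos hB hz hij (sub_pos.2 h1)
      have h3 := hdiff i
      have h4 := hz i
      simp only [T, Finset.mem_filter, Finset.mem_univ, true_and]
      linarith
    have hall : ∀ i ∈ S, i ∈ T y := by
      intro i hi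
      have hpath := hconn i hi j₀ (hTS _ hj₀)
      clear hi
      induction hpath using Relation.ReflTransGen.head_induction_on with
      | refl => exact hj₀
      | head hab _ ih => exact hclosed _ _ hab ih
    have hpos : ∀ i ∈ S, 0 < z i := fun i hi => by
      have : m * y i < (B.mulVec y) i := by simpa [T] using hall i hi
      exact sub_pos.2 this
    obtain ⟨ε, hε, hεz⟩ : ∃ ε : ℝ, 0 < ε ∧ ∀ i ∈ S, ε * y i ≤ z i := by
      have : ∀ i : V, ∃ ε : ℝ, 0 < ε ∧ (i ∈ S → ε * y i ≤ z i) := by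
        intro i
        by_cases hi : i ∈ S
        · refine ⟨z i / (y i + 1), div_pos (hpos i hi) (by linarith [hy.1 i]), fun _ => ?_⟩
          have h1 : 0 < y i + 1 := by linarith [hy.1 i]
          rw [div_mul_eq_mul_div, div_le_iff₀ h1]
          nlinarith [hpos i hi]
        · exact ⟨1, one_pos, fun h => absurd h hi⟩
      choose f hf hf' using this
      have hne : (Finset.univ : Finset V).Nonempty := ⟨j₀, Finset.mem_univ _⟩
      refine ⟨Finset.univ.inf' hne f, (Finset.lt_inf'_iff hne).2 fun i _ => hf i, fun i hi => ?_⟩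
      exact (mul_le_mul_of_nonneg_right (Finset.inf'_le f (Finset.mem_univ i)) (hy.1 i)).trans
        (hf' i hi)
    have := hmax (m + ε) y ⟨hy.1, hy.2.1, hy.2.2.1, fun i => ?_⟩
    · linarith
    · by_cases hi : i ∈ S
      · have := hεz i hi
        simp only [z] at this
        linarith
      · simp [hB0 i hi, hy.2.2.1 i hi]
  refine ⟨key x hx, fun i hi => ?_⟩
  obtain ⟨j, hj⟩ := Function.ne_iff.1 hx.2.1
  have hj' : 0 < x j := lt_of_le_of_ne (hx.1 j) (Ne.symm hj)
  have hjS : j ∈ S := by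
    by_contra h
    exact hj (hx.2.2.1 j h)
  have hpath := hconn i hi j hjS
  clear hi
  induction hpath using Relation.ReflTransGen.head_induction_on with
  | refl => exact hj'
  | @head a b hab _ ih =>
    have h1 := mulVec_pos_of_pos hB hx.1 hab ih
    rw [key x hx] at h1
    exact lt_of_le_of_ne (hx.1 a) fun h => by rw [← h] at h1; simp at h1

end Matrix

/-! ### Three eigenvalues force criticality -/

namespace Digraph

variable {V : Type*}

/-- The subdigraph of `D` induced by `S` is strongly connected. -/
def StrongOn (D : Digraph V) (S : Set V) : Prop :=
  ∀ x ∈ S, ∀ y ∈ S, Relation.ReflTransGen (fun a b => D.Adj a b ∧ a ∈ S ∧ b ∈ S) x y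

/-- The closed walk `c 0, c 1, …` in `D` has period `s`. -/
def IsClosedWalk (D : Digraph V) (s : ℕ) (c : ℕ → V) : Prop :=
  0 < s ∧ (∀ i, c (i + s) = c i) ∧ ∀ i, D.Adj (c i) (c (i + 1))

/-- A closed walk without repeated vertices whose vertices induce no further arcs. -/
def IsInducedCycle (D : Digraph V) (s : ℕ) (c : ℕ → V) : Prop :=
  D.IsClosedWalk s c ∧ (∀ i j, c i = c j → i ≡ j [MOD s]) ∧
    ∀ i j, D.Adj (c i) (c j) → j ≡ i + 1 [MOD s]

theorem IsClosedWalk.apply_eq {D : Digraph V} {s : ℕ} {c : ℕ → V} (h : D.IsClosedWalk s c)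
    {i j : ℕ} (hij : i ≡ j [MOD s]) : c i = c j := by
  have key : ∀ i k, c (i + k * s) = c i := by
    intro i k
    induction k with
    | zero => simp
    | succ k ih => rw [Nat.succ_mul, ← add_assoc, h.2.1, ih]
  have hmod : ∀ i, c i = c (i % s) := by
    intro i
    conv_lhs => rw [← Nat.mod_add_div i s, mul_comm]
    exact key _ _
  rw [hmod i, hmod j, hij]

theorem StrongOn.exists_adj {D : Digraph V} {S : Set V} (hS : D.StrongOn S) {x y : V} (hx : x ∈ S)
    (hy : y ∈ S) (hxy : x ≠ y) : ∃ z ∈ S, D.Adj x z := by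
  rcases Relation.ReflTransGen.cases_head (hS x hx y hy) with h | ⟨z, hz, -⟩
  · exact absurd h hxy
  · exact ⟨z, hz.2.2, hz.1⟩

section Spectrum

variable [Fintype V] {D : Digraph V}

theorem zero_mem_complementaritySpectrum (hsimple : D.IsSimple) (v : V) :
    (0 : ℝ) ∈ D.complementaritySpectrum := by
  classical
  refine ⟨Pi.single v 1, ?_, ?_, ?_, ?_⟩
  · simp
  · intro i
    by_cases h : i = v
    · subst h; simp
    · simp [h]
  · intro i
    simp only [zero_mul, Matrix.mulVec_single_one, adjMatrix, Matrix.col_apply, Matrix.of_apply]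
    split_ifs <;> norm_num
  · simp [adjMatrix, hsimple v]

/-- Outside `S` the inequality is nonnegativity of the adjacency matrix, and complementarity holds
because `x` vanishes there. Hence eigenvectors of induced subdigraphs can be extended by zero. -/
theorem mem_complementaritySpectrum_of_eigenvector {S : Set V} {t : ℝ} {x : V → ℝ} (hne : x ≠ 0)
    (hx : ∀ i, 0 ≤ x i) (hS : ∀ i, i ∉ S → x i = 0)
    (heig : ∀ i ∈ S, (D.adjMatrix.mulVec x) i = t * x i) : t ∈ D.complementaritySpectrum := by
  classical
  refine ⟨x, hne, hx, fun i => ?_, ?_⟩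
  · by_cases hi : i ∈ S
    · exact (heig i hi).ge
    · rw [hS i hi, mul_zero]
      refine Matrix.mulVec_nonneg_of_nonneg (fun i j => ?_) hx i
      simp only [adjMatrix, Matrix.of_apply]
      split_ifs <;> norm_num
  · refine Finset.sum_eq_zero fun i _ => ?_
    by_cases hi : i ∈ S
    · simp [heig i hi]
    · simp [hS i hi]

theorem IsInducedCycle.one_mem_complementaritySpectrum {s : ℕ} {c : ℕ → V}
    (h : D.IsInducedCycle s c) : (1 : ℝ) ∈ D.complementaritySpectrum := by
  classical
  refine mem_complementaritySpectrum_of_eigenvector (S := Set.range c)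
    (x := fun i => if i ∈ Set.range c then 1 else 0) ?_ ?_ ?_ ?_
  · intro h0
    have := congrFun h0 (c 0)
    simp at this
  · intro i
    split_ifs <;> norm_num
  · intro i hi
    simp [hi]
  · rintro _ ⟨k, rfl⟩
    simp only [Matrix.mulVec, dotProduct]
    rw [Finset.sum_eq_single (c (k + 1))]
    · simp [adjMatrix, h.1.2.2 k]
    · intro b _ hb
      by_cases hbr : b ∈ Set.range c
      · obtain ⟨j, rfl⟩ := hbr
        have : ¬ D.Adj (c k) (c j) := fun hadj => hb (h.1.apply_eq (h.2.2 k j hadj))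
        simp [adjMatrix, this]
      · simp [hbr]
    · intro h; exact absurd (Finset.mem_univ _) h

open Classical in
/-- The spectral radius of a strongly connected induced subdigraph is a complementarity
eigenvalue. -/
theorem StrongOn.exists_max_eigenvalue {S : Set V} (hS : D.StrongOn S) (hne : S.Nonempty) :
    ∃ m ∈ D.complementaritySpectrum, ∃ x : V → ℝ, (∀ i, 0 ≤ x i) ∧ x ≠ 0 ∧ (∀ i, i ∉ S → x i = 0) ∧
      (∀ i, m * x i ≤ (D.adjMatrix.mulVec x) i) ∧
      ∀ t y, (∀ i, 0 ≤ y i) → y ≠ 0 → (∀ i, i ∉ S → y i = 0) →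
        (∀ i ∈ S, t * y i ≤ (D.adjMatrix.mulVec y) i) →
        t < m ∨ (t = m ∧ ∀ i ∈ S, 0 < y i ∧ (D.adjMatrix.mulVec y) i = t * y i) := by
  -- The adjacency matrix of the induced subdigraph, padded by zeros; on vectors supported in `S` it
  -- agrees with that of `D` in the rows of `S`.
  set B : Matrix V V ℝ := Matrix.of fun i j => if i ∈ S ∧ j ∈ S then D.adjMatrix i j else 0 with hBdef
  have hA : ∀ i j, 0 ≤ D.adjMatrix i j := by
    intro i j
    simp only [adjMatrix, Matrix.of_apply]
    split_ifs <;> norm_num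
  have hB : ∀ i j, 0 ≤ B i j := by
    intro i j
    simp only [hBdef, Matrix.of_apply]
    split_ifs
    exacts [hA i j, le_rfl]
  have hBS : ∀ i j, 0 < B i j → i ∈ S := by
    intro i j hij
    by_contra h
    simp [hBdef, h] at hij
  have hconn : ∀ i ∈ S, ∀ j ∈ S, Relation.ReflTransGen (fun a b => 0 < B a b) i j := by
    intro i hi j hj
    refine Relation.ReflTransGen.mono ?_ _ _ (hS i hi j hj)
    rintro a b ⟨hab, ha, hb⟩
    simp [hBdef, ha, hb, adjMatrix, hab]
  have hBA : ∀ y : V → ℝ, (∀ i, i ∉ S → y i = 0) → ∀ i ∈ S,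
      (B.mulVec y) i = (D.adjMatrix.mulVec y) i := by
    intro y hy i hi
    refine Finset.sum_congr rfl fun j _ => ?_
    by_cases hj : j ∈ S
    · simp [hBdef, hi, hj]
    · simp [hy j hj]
  have hBout : ∀ y : V → ℝ, ∀ i, i ∉ S → (B.mulVec y) i = 0 := by
    intro y i hi
    refine Finset.sum_eq_zero fun j _ => ?_
    simp [hBdef, hi]
  obtain ⟨m, x, hx, hmax⟩ := B.exists_max_isSubeigenvector S hne hB
  have hxe := hx.eq_of_isMax hB hBS hconn hmax
  have hmem : ∀ i ∈ S, (D.adjMatrix.mulVec x) i = m * x i := fun i hi => by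
    rw [← hBA x hx.2.2.1 i hi, hxe.1]
  refine ⟨m, mem_complementaritySpectrum_of_eigenvector hx.2.1 hx.1 hx.2.2.1 hmem, x, hx.1, hx.2.1,
    hx.2.2.1, fun i => ?_, ?_⟩
  · by_cases hi : i ∈ S
    · exact (hmem i hi).ge
    · rw [hx.2.2.1 i hi, mul_zero]
      exact Matrix.mulVec_nonneg_of_nonneg hA hx.1 i
  · intro t y hy hyne hyS hty
    have hsub : B.IsSubeigenvector S t y := by
      refine ⟨hy, hyne, hyS, fun i => ?_⟩
      by_cases hi : i ∈ S
      · rw [hBA y hyS i hi]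
        exact hty i hi
      · simp [hBout y i hi, hyS i hi]
    rcases (hmax t y hsub).lt_or_eq with h | rfl
    · exact Or.inl h
    · have := hsub.eq_of_isMax hB hBS hconn hmax
      exact Or.inr ⟨rfl, fun i hi => ⟨this.2 i hi, by rw [← hBA y hyS i hi, this.1]⟩⟩

/-- If `D` has only three complementarity eigenvalues, then each proper strongly connected induced
subdigraph has out-degrees at most one. -/
theorem StrongOn.eq_univ_of_ncard_eq_three (hsimple : D.IsSimple) (hconn : D.StronglyConnected)
    (hthree : D.complementaritySpectrum.ncard = 3) {s : ℕ} {c : ℕ → V} (hc : D.IsInducedCycle s c)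
    {S : Set V} (hS : D.StrongOn S) {w a b : V} (hw : w ∈ S) (ha : a ∈ S) (hb : b ∈ S)
    (hab : a ≠ b) (hwa : D.Adj w a) (hwb : D.Adj w b) : S = Set.univ := by
  classical
  by_contra hSne
  have huniv : D.StrongOn Set.univ := by
    intro x _ y _
    exact Relation.ReflTransGen.mono (fun a b h => ⟨h, trivial, trivial⟩) _ _ (hconn x y)
  obtain ⟨n, hn, -, -, -, -, -, hnmax⟩ := huniv.exists_max_eigenvalue ⟨w, trivial⟩
  obtain ⟨m, hm, x, hx0, hxne, hxS, hx, hmmax⟩ := hS.exists_max_eigenvalue ⟨w, hw⟩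
  -- Extended by zero, the Perron vector of `S` competes in the maximum for `D`. Equality would make
  -- it positive everywhere, but it vanishes outside `S`.
  have hmn : m < n := by
    obtain ⟨v, hv⟩ := (Set.ne_univ_iff_exists_notMem S).1 hSne
    rcases hnmax m x hx0 hxne (fun i hi => absurd trivial hi) (fun i _ => hx i) with h | ⟨-, h⟩
    · exact h
    · exact absurd (hxS v hv) (h v trivial).1.ne'
  have hdeg : ∀ i ∈ S, ∃ j ∈ S, D.Adj i j := by
    intro i hi
    by_cases hia : i = a
    · exact hS.exists_adj hi hb (hia ▸ hab)
    · exact hS.exists_adj hi ha hia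
  -- Every vertex of `S` has an out-neighbour in `S`, so the indicator of `S` shows `1 ≤ m`.
  -- Equality would make it an eigenvector for 1, which fails at `w` because of its two
  -- out-neighbours.
  have hm1 : 1 < m := by
    let y : V → ℝ := fun i => if i ∈ S then 1 else 0
    have hterm : ∀ i j, 0 ≤ D.adjMatrix i j * y j := by
      intro i j
      simp only [adjMatrix, Matrix.of_apply, y]
      split_ifs <;> norm_num
    have hy0 : ∀ i, 0 ≤ y i := by
      intro i
      simp only [y]
      split_ifs <;> norm_num
    have hyne : y ≠ 0 := by
      intro h
      have := congrFun h w
      simp [y, hw] at this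
    have hyS : ∀ i ∈ S, 1 * y i ≤ (D.adjMatrix.mulVec y) i := by
      intro i hi
      obtain ⟨j, hj, hij⟩ := hdeg i hi
      have h2 : D.adjMatrix i j * y j ≤ (D.adjMatrix.mulVec y) i :=
        Finset.single_le_sum (f := fun j => D.adjMatrix i j * y j) (fun j _ => hterm i j)
          (Finset.mem_univ j)
      have h3 : D.adjMatrix i j * y j = 1 := by simp [adjMatrix, hij, y, hj]
      have h4 : y i = 1 := by simp [y, hi]
      linarith
    rcases hmmax 1 y hy0 hyne (fun i hi => by simp [y, hi]) hyS with h | ⟨-, h⟩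
    · exact h
    · exfalso
      have h1 := (h w hw).2
      have h2 : ∑ j ∈ {a, b}, D.adjMatrix w j * y j ≤ (D.adjMatrix.mulVec y) w :=
        Finset.sum_le_sum_of_subset_of_nonneg (Finset.subset_univ _) fun j _ _ => hterm w j
      rw [Finset.sum_pair hab, h1] at h2
      simp only [adjMatrix, Matrix.of_apply, hwa, hwb, y, ha, hb, hw, if_true] at h2
      norm_num at h2
  -- `ncard` is 0 on infinite sets, so the value three also yields finiteness.
  have hfin : D.complementaritySpectrum.Finite := Set.finite_of_ncard_ne_zero (by omega)
  have hsub : (({0, 1, m, n} : Finset ℝ) : Set ℝ) ⊆ D.complementaritySpectrum := by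
    intro t ht
    simp only [Finset.coe_insert, Finset.coe_singleton, Set.mem_insert_iff,
      Set.mem_singleton_iff] at ht
    rcases ht with rfl | rfl | rfl | rfl
    exacts [zero_mem_complementaritySpectrum hsimple w, hc.one_mem_complementaritySpectrum, hm, hn]
  have hle := Set.ncard_le_ncard hsub hfin
  rw [Set.ncard_coe_finset, hthree] at hle
  have hcard : ({0, 1, m, n} : Finset ℝ).card = 4 := by
    rw [Finset.card_insert_of_notMem, Finset.card_insert_of_notMem, Finset.card_insert_of_notMem,
      Finset.card_singleton]
    · simp [hmn.ne]
    · simp only [Finset.mem_insert, Finset.mem_singleton, not_or]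
      exact ⟨hm1.ne, (hm1.trans hmn).ne⟩
    · simp only [Finset.mem_insert, Finset.mem_singleton, not_or]
      exact ⟨by norm_num, by linarith, by linarith⟩
  omega

end Spectrum

end Digraph

/-! ### Critical digraphs, shortest cycles and shortest ears -/

namespace Digraph

variable {V : Type*} {D : Digraph V}

/-- Strongly connected induced subdigraphs in which some vertex has out-degree at least two are
spanning. -/
def IsCritical (D : Digraph V) : Prop :=
  ∀ S : Set V, D.StrongOn S → ∀ w ∈ S, ∀ a ∈ S, ∀ b ∈ S, a ≠ b → D.Adj w a → D.Adj w b →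
    ∀ x, x ∈ S

theorem strongOn_image_Iic {f : ℕ → V} {d : ℕ} (hf : ∀ i < d, D.Adj (f i) (f (i + 1)))
    (hd : D.Adj (f d) (f 0)) : D.StrongOn (f '' Set.Iic d) := by
  set R := fun a b => D.Adj a b ∧ a ∈ f '' Set.Iic d ∧ b ∈ f '' Set.Iic d with hR
  have hmem : ∀ i ≤ d, f i ∈ f '' Set.Iic d := fun i hi => ⟨i, hi, rfl⟩
  have h1 : ∀ i k, i + k ≤ d → Relation.ReflTransGen R (f i) (f (i + k)) := by
    intro i k
    induction k with
    | zero => exact fun _ => .refl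
    | succ k ih =>
      intro h
      exact (ih (by omega)).tail ⟨hf _ (by omega), hmem _ (by omega), hmem _ (by omega)⟩
  rintro _ ⟨i, hi, rfl⟩ _ ⟨j, hj, rfl⟩
  simp only [Set.mem_Iic] at hi hj
  have h2 := h1 i (d - i) (by omega)
  have h3 := h1 0 j (by omega)
  rw [Nat.add_sub_cancel' hi] at h2
  rw [zero_add] at h3
  exact (h2.tail ⟨hd, hmem _ le_rfl, hmem _ (by omega)⟩).trans h3

theorem StrongOn.union {S T : Set V} (hS : D.StrongOn S) (hT : D.StrongOn T) {z : V} (hzS : z ∈ S)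
    (hzT : z ∈ T) : D.StrongOn (S ∪ T) := by
  have h1 : ∀ x ∈ S, ∀ y ∈ S,
      Relation.ReflTransGen (fun a b => D.Adj a b ∧ a ∈ S ∪ T ∧ b ∈ S ∪ T) x y := fun x hx y hy =>
    Relation.ReflTransGen.mono (fun a b h => ⟨h.1, Or.inl h.2.1, Or.inl h.2.2⟩) _ _ (hS x hx y hy)
  have h2 : ∀ x ∈ T, ∀ y ∈ T,
      Relation.ReflTransGen (fun a b => D.Adj a b ∧ a ∈ S ∪ T ∧ b ∈ S ∪ T) x y := fun x hx y hy =>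
    Relation.ReflTransGen.mono (fun a b h => ⟨h.1, Or.inr h.2.1, Or.inr h.2.2⟩) _ _ (hT x hx y hy)
  rintro x (hx | hx) y (hy | hy)
  · exact h1 x hx y hy
  · exact (h1 x hx z hzS).trans (h2 z hzT y hy)
  · exact (h2 x hx z hzT).trans (h1 z hzS y hy)
  · exact h2 x hx y hy

/-- A shortest closed walk works: an arc from `c i` to `c j` closes up the stretch from `c j` to `c
i`, which by minimality has full length. A repeated vertex would produce such a chord. -/
theorem exists_isInducedCycle [Finite V] [Nonempty V] (hout : ∀ x, ∃ y, D.Adj x y) :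
    ∃ s c, D.IsInducedCycle s c := by
  classical
  have hex : ∃ s c, D.IsClosedWalk s c := by
    choose f hf using hout
    let x₀ : V := Classical.arbitrary V
    obtain ⟨i, j, hne, hij⟩ := Finite.exists_ne_map_eq_of_infinite fun i : ℕ => f^[i] x₀
    wlog hlt : i < j generalizing i j
    · exact this j i hne.symm hij.symm (by omega)
    refine ⟨j - i, fun k => f^[k] (f^[i] x₀), by omega, fun k => ?_, fun k => ?_⟩
    · have : f^[j - i] (f^[i] x₀) = f^[i] x₀ := by
        rw [← Function.iterate_add_apply, Nat.sub_add_cancel hlt.le]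
        exact hij.symm
      simp only [Function.iterate_add_apply, this]
    · simp only [Function.iterate_succ_apply' f k]
      exact hf _
  set s := Nat.find hex with hs
  obtain ⟨c, hc⟩ := Nat.find_spec hex
  have hs0 : 0 < s := hc.1
  have hchord : ∀ i j, D.Adj (c i) (c j) → j ≡ i + 1 [MOD s] := by
    intro i j hij
    -- The residue of `i - j` modulo `s`, written without subtraction.
    set d := (i + (s - 1) * j) % s with hd
    have hds : d < s := Nat.mod_lt _ hs0
    have hjd : j + d ≡ i [MOD s] := by
      calc j + d ≡ j + (i + (s - 1) * j) [MOD s] := (Nat.mod_modEq _ _).add_left j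
        _ = i + s * j := by
          obtain ⟨t, ht⟩ : ∃ t, s = t + 1 := ⟨s - 1, by omega⟩
          rw [ht, Nat.add_sub_cancel]; ring
        _ ≡ i [MOD s] := by simp [Nat.ModEq]
    have hwalk : D.IsClosedWalk (d + 1) fun k => c (j + k % (d + 1)) := by
      refine ⟨by omega, fun k => by simp, fun k => ?_⟩
      have hk : k % (d + 1) < d + 1 := Nat.mod_lt _ (by omega)
      by_cases h : k % (d + 1) = d
      · have h1 : (k + 1) % (d + 1) = 0 := by rw [Nat.add_mod, h]; simp
        simp only [h, h1, add_zero]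
        rwa [hc.apply_eq hjd]
      · have h1 : (k + 1) % (d + 1) = k % (d + 1) + 1 := by
          rw [← Nat.mod_add_mod]
          exact Nat.mod_eq_of_lt (by omega)
        simp only [h1]
        exact hc.2.2 _
    have hmin : s ≤ d + 1 := Nat.find_min' hex ⟨_, hwalk⟩
    have hd1 : d + 1 = s := by omega
    calc j ≡ j + s [MOD s] := by simp [Nat.ModEq]
      _ = (j + d) + 1 := by omega
      _ ≡ i + 1 [MOD s] := hjd.add_right 1
  refine ⟨s, c, hc, fun i j hij => ?_, hchord⟩
  have h1 := hc.2.2 i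
  rw [hij] at h1
  exact Nat.ModEq.add_right_cancel' 1 (hchord _ _ h1)

/-- `p 0, …, p (m - 1)` are the inner vertices of a shortest ear of the induced cycle `c`, and all
vertices belong to the ear or to the cycle. -/
structure IsEar (D : Digraph V) (s : ℕ) (c : ℕ → V) (m : ℕ) (p : ℕ → V) : Prop where
  cycle : D.IsInducedCycle s c
  two_le : 2 ≤ s
  pos : 0 < m
  ne : ∀ k < m, ∀ i, p k ≠ c i
  adj : ∀ k, k + 1 < m → D.Adj (p k) (p (k + 1))
  inj : ∀ k < m, ∀ l < m, p k = p l → k = l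
  eq_zero : ∀ i, ∀ k < m, D.Adj (c i) (p k) → k = 0
  eq_last : ∀ k < m, ∀ i, D.Adj (p k) (c i) → k = m - 1
  le_succ : ∀ k < m, ∀ l < m, D.Adj (p k) (p l) → l ≤ k + 1
  source : ∃ i, D.Adj (c i) (p 0)
  target : ∃ j, D.Adj (p (m - 1)) (c j)
  cover : ∀ x, (∃ i, x = c i) ∨ ∃ k < m, x = p k

theorem exists_adj_of_reflTransGen {S : Set V} {x z : V} (h : Relation.ReflTransGen D.Adj x z)
    (hx : x ∈ S) (hz : z ∉ S) : ∃ a ∈ S, ∃ b, b ∉ S ∧ D.Adj a b := by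
  induction h using Relation.ReflTransGen.head_induction_on with
  | refl => exact absurd hx hz
  | @head a b hab _ ih =>
    by_cases hb : b ∈ S
    · exact ih hb
    · exact ⟨a, hx, b, hb, hab⟩

theorem exists_walk_to_set {S : Set V} {y t : V} (h : Relation.ReflTransGen D.Adj y t)
    (hy : y ∉ S) (ht : t ∈ S) : ∃ (m : ℕ) (p : ℕ → V), 0 < m ∧ p 0 = y ∧ (∀ k < m, p k ∉ S) ∧
      (∀ k, k + 1 < m → D.Adj (p k) (p (k + 1))) ∧ ∃ z ∈ S, D.Adj (p (m - 1)) z := by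
  induction h using Relation.ReflTransGen.head_induction_on with
  | refl => exact absurd ht hy
  | @head a b hab _ ih =>
    by_cases hb : b ∈ S
    · exact ⟨1, fun _ => a, one_pos, rfl, fun _ _ => hy, fun k hk => by omega, b, hb, hab⟩
    · obtain ⟨m, p, hm, h0, hS, hadj, z, hz, hlast⟩ := ih hb
      refine ⟨m + 1, fun k => if k = 0 then a else p (k - 1), by omega, by simp, ?_, ?_, z, hz, ?_⟩
      · intro k hk
        by_cases hk0 : k = 0
        · simpa [hk0] using hy
        · simpa [hk0] using hS (k - 1) (by omega)
      · intro k hk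
        by_cases hk0 : k = 0
        · simpa [hk0, h0] using hab
        · have := hadj (k - 1) (by omega)
          rw [Nat.sub_add_cancel (by omega)] at this
          simpa [hk0] using this
      · simpa [hm.ne'] using hlast

theorem IsClosedWalk.strongOn {s : ℕ} {c : ℕ → V} (h : D.IsClosedWalk s c) :
    D.StrongOn (Set.range c) := by
  have hs := h.1
  have h1 : Set.range c = c '' Set.Iic (s - 1) := by
    ext x
    constructor
    · rintro ⟨i, rfl⟩
      have hi := Nat.mod_lt i hs
      exact ⟨i % s, by simp only [Set.mem_Iic]; omega, h.apply_eq (Nat.mod_modEq i s)⟩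
    · rintro ⟨i, -, rfl⟩
      exact ⟨i, rfl⟩
  rw [h1]
  refine strongOn_image_Iic (fun i _ => h.2.2 i) ?_
  have h2 := h.2.2 (s - 1)
  rw [Nat.sub_add_cancel hs] at h2
  rwa [← h.apply_eq (show s ≡ 0 [MOD s] by simp [Nat.ModEq])]

theorem IsClosedWalk.two_le (hsimple : D.IsSimple) {s : ℕ} {c : ℕ → V} (h : D.IsClosedWalk s c) :
    2 ≤ s := by
  by_contra hlt
  have h1 : s = 1 := by have := h.1; omega
  subst h1
  have h2 := h.2.2 0
  rw [h.2.1 0] at h2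
  exact hsimple _ h2

/-- The vertices of an ear and of a part of the cycle form a closed walk. -/
theorem strongOn_ear {s m : ℕ} {c p : ℕ → V} (hc : D.IsClosedWalk s c) (hm : 0 < m)
    (hp : ∀ k, k + 1 < m → D.Adj (p k) (p (k + 1))) {j q : ℕ} (hj : D.Adj (p (m - 1)) (c j))
    (hq : D.Adj (c (j + q)) (p 0)) : D.StrongOn (p '' Set.Iio m ∪ c '' Set.Icc j (j + q)) := by
  let f : ℕ → V := fun t => if t < m then p t else c (j + (t - m))
  have h1 : p '' Set.Iio m ∪ c '' Set.Icc j (j + q) = f '' Set.Iic (m + q) := by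
    ext x
    constructor
    · rintro (⟨k, hk, rfl⟩ | ⟨i, hi, rfl⟩)
      · simp only [Set.mem_Iio] at hk
        exact ⟨k, by simp only [Set.mem_Iic]; omega, by simp [f, hk]⟩
      · simp only [Set.mem_Icc] at hi
        refine ⟨m + (i - j), by simp only [Set.mem_Iic]; omega, ?_⟩
        simp [f, Nat.add_sub_cancel' hi.1]
    · rintro ⟨t, ht, rfl⟩
      simp only [Set.mem_Iic] at ht
      by_cases h : t < m
      · exact Or.inl ⟨t, h, by simp [f, h]⟩
      · exact Or.inr ⟨j + (t - m), by simp only [Set.mem_Icc]; omega, by simp [f, h]⟩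
  rw [h1]
  refine strongOn_image_Iic (fun i hi => ?_) ?_
  · by_cases h2 : i + 1 < m
    · simpa [f, h2, show i < m by omega] using hp i h2
    · by_cases h3 : i < m
      · obtain rfl : i = m - 1 := by omega
        simpa [f, h3, show ¬ (m - 1 + 1 < m) by omega, show m - 1 + 1 - m = 0 by omega] using hj
      · have := hc.2.2 (j + (i - m))
        simpa [f, h2, h3, show i + 1 - m = i - m + 1 by omega, ← add_assoc] using this
  · simpa [f, hm] using hq

/-- Take a walk of minimal length that leaves the cycle and returns to it. Any arc other than those
allowed in `IsEar` would shorten it. The cycle and the ear together are strongly connected and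
branch where the ear starts, so by criticality they span. -/
theorem exists_isEar (hsimple : D.IsSimple) (hconn : D.StronglyConnected) (hcrit : D.IsCritical)
    {s : ℕ} {c : ℕ → V} (hc : D.IsInducedCycle s c) {z : V} (hz : z ∉ Set.range c) :
    ∃ m p, D.IsEar s c m p := by
  classical
  have hex : ∃ (m : ℕ) (p : ℕ → V), 0 < m ∧ (∀ k < m, p k ∉ Set.range c) ∧
      (∀ k, k + 1 < m → D.Adj (p k) (p (k + 1))) ∧ (∃ i, D.Adj (c i) (p 0)) ∧
      ∃ j, D.Adj (p (m - 1)) (c j) := by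
    obtain ⟨a, ⟨i, rfl⟩, b, hb, hab⟩ := exists_adj_of_reflTransGen (S := Set.range c)
      (hconn (c 0) z) ⟨0, rfl⟩ hz
    obtain ⟨m, p, hm, h0, hS, hadj, _, ⟨j, rfl⟩, hlast⟩ :=
      exists_walk_to_set (hconn b (c 0)) hb ⟨0, rfl⟩
    exact ⟨m, p, hm, hS, hadj, ⟨i, h0 ▸ hab⟩, j, hlast⟩
  obtain ⟨p, hm0, hS, hadj, ⟨u, hu⟩, v, hv⟩ := Nat.find_spec hex
  set m := Nat.find hex with hm
  have hmin : ∀ (m' : ℕ) (p' : ℕ → V), 0 < m' → (∀ k < m', p' k ∉ Set.range c) →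
      (∀ k, k + 1 < m' → D.Adj (p' k) (p' (k + 1))) → (∃ i, D.Adj (c i) (p' 0)) →
      (∃ j, D.Adj (p' (m' - 1)) (c j)) → m ≤ m' := fun m' p' h1 h2 h3 h4 h5 =>
    Nat.find_min' hex ⟨p', h1, h2, h3, h4, h5⟩
  have hlast : ∀ k < m, ∀ i, D.Adj (p k) (c i) → k = m - 1 := by
    intro k hk i h
    have := hmin (k + 1) p (by omega) (fun l hl => hS l (by omega)) (fun l hl => hadj l (by omega))
      ⟨u, hu⟩ ⟨i, h⟩
    omega
  have hle : ∀ k < m, ∀ l < m, D.Adj (p k) (p l) → l ≤ k + 1 := by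
    intro k hk l hl h
    by_contra hlt
    -- The arc from `p k` to `p l` bypasses the `l - k - 1` vertices in between.
    have := hmin (m - (l - k - 1)) (fun t => if t ≤ k then p t else p (t + (l - k - 1))) (by omega)
      (fun t ht => by
        split_ifs
        exacts [hS t (by omega), hS _ (by omega)])
      (fun t ht => by
        by_cases h1 : t + 1 ≤ k
        · simpa [h1, show t ≤ k by omega] using hadj t (by omega)
        · by_cases h2 : t ≤ k
          · obtain rfl : t = k := by omega
            simpa [show t + 1 + (l - t - 1) = l by omega] using h
          · have := hadj (t + (l - k - 1)) (by omega)
            simpa [h1, h2, show t + 1 + (l - k - 1) = t + (l - k - 1) + 1 by omega] using this)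
      ⟨u, by simpa using hu⟩
      ⟨v, by
        simpa [show ¬ (m - (l - k - 1) - 1 ≤ k) by omega,
          show m - (l - k - 1) - 1 + (l - k - 1) = m - 1 by omega] using hv⟩
    omega
  -- A repetition lets `p k` use the arc out of `p l`, which is a forward shortcut or an early
  -- return to the cycle.
  have hinj : ∀ k < m, ∀ l < m, p k = p l → k ≤ l → k = l := by
    intro k hk l hl h hkl
    by_cases h1 : l + 1 < m
    · have h2 := hadj l h1
      rw [← h] at h2
      have := hle k hk (l + 1) h1 h2
      omega
    · obtain rfl : l = m - 1 := by omega
      rw [← h] at hv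
      exact hlast k hk v hv
  refine ⟨m, p, hc, hc.1.two_le hsimple, hm0, fun k hk i h => hS k hk ⟨i, h.symm⟩, hadj, ?_, ?_,
    hlast, hle, ⟨u, hu⟩, ⟨v, hv⟩, ?_⟩
  · intro k hk l hl h
    rcases le_total k l with h1 | h1
    · exact hinj k hk l hl h h1
    · exact (hinj l hl k hk h.symm h1).symm
  · intro i k hk h
    have := hmin (m - k) (fun t => p (t + k)) (by omega) (fun l hl => hS _ (by omega))
      (fun l hl => by
        have := hadj (l + k) (by omega)
        rwa [show l + k + 1 = l + 1 + k by omega] at this)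
      ⟨i, by simpa using h⟩ ⟨v, by simpa [show m - k - 1 + k = m - 1 by omega] using hv⟩
    omega
  -- `q` steps along the cycle lead from the end `c v` of the ear to its start `c u`, which closes
  -- the walk.
  · obtain ⟨q, hq⟩ : ∃ q, v + q ≡ u [MOD s] := by
      refine ⟨u + (s - 1) * v, ?_⟩
      obtain ⟨t, ht⟩ : ∃ t, s = t + 1 := ⟨s - 1, by have := hc.1.1; omega⟩
      rw [show v + (u + (s - 1) * v) = u + s * v by rw [ht, Nat.add_sub_cancel]; ring]
      simp [Nat.ModEq]
    have h1 := strongOn_ear hc.1 hm0 hadj hv (q := q) (by rwa [hc.1.apply_eq hq])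
    have h2 := hc.1.strongOn.union h1 (z := c v) ⟨v, rfl⟩ (Or.inr ⟨v, by simp, rfl⟩)
    intro x
    rcases hcrit _ h2 (c u) (Or.inl ⟨u, rfl⟩) (c (u + 1)) (Or.inl ⟨_, rfl⟩) (p 0)
      (Or.inr (Or.inl ⟨0, hm0, rfl⟩)) (fun h => hS 0 hm0 ⟨_, h⟩) (hc.1.2.2 u) hu x with
      ⟨i, hi⟩ | ⟨k, hk, hk'⟩ | ⟨i, -, hi⟩
    exacts [Or.inl ⟨i, hi.symm⟩, Or.inr ⟨k, hk, hk'.symm⟩, Or.inl ⟨i, hi.symm⟩]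

/-! ### Positions of starts, ends and backward arcs -/

namespace IsEar

variable {s m : ℕ} {c p : ℕ → V}

/-- An ear of a cycle is an ear of the rotated cycle. -/
theorem rotate (h : D.IsEar s c m p) (r : ℕ) : D.IsEar s (fun i => c (i + r)) m p := by
  have hs := h.cycle.1.1
  have hsurj : ∀ i, ∃ j, c i = c (j + r) := by
    intro i
    refine ⟨i + (s - 1) * r, h.cycle.1.apply_eq ?_⟩
    obtain ⟨t, ht⟩ : ∃ t, s = t + 1 := ⟨s - 1, by omega⟩
    rw [show i + (s - 1) * r + r = i + s * r by rw [ht, Nat.add_sub_cancel]; ring]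
    simp [Nat.ModEq]
  refine ⟨⟨⟨hs, fun i => ?_, fun i => ?_⟩, fun i j hij => ?_, fun i j hij => ?_⟩, h.two_le, h.pos,
    fun k hk i => h.ne k hk _, h.adj, h.inj, fun i => h.eq_zero _, fun k hk i => h.eq_last k hk _,
    h.le_succ, ?_, ?_, ?_⟩
  · have := h.cycle.1.2.1 (i + r)
    rwa [show i + r + s = i + s + r by omega] at this
  · have := h.cycle.1.2.2 (i + r)
    rwa [show i + r + 1 = i + 1 + r by omega] at this
  · exact Nat.ModEq.add_right_cancel' r (h.cycle.2.1 _ _ hij)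
  · have := h.cycle.2.2 _ _ hij
    rw [show i + r + 1 = i + 1 + r by omega] at this
    exact Nat.ModEq.add_right_cancel' r this
  · obtain ⟨i, hi⟩ := h.source
    obtain ⟨j, hj⟩ := hsurj i
    exact ⟨j, hj ▸ hi⟩
  · obtain ⟨i, hi⟩ := h.target
    obtain ⟨j, hj⟩ := hsurj i
    exact ⟨j, hj ▸ hi⟩
  · intro x
    rcases h.cover x with ⟨i, rfl⟩ | hx
    · exact Or.inl (hsurj i)
    · exact Or.inr hx

theorem apply_add (h : D.IsEar s c m p) (i : ℕ) : c (i + s) = c i := h.cycle.1.2.1 i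

theorem apply_inj (h : D.IsEar s c m p) {i j : ℕ} (hi : i < s) (hj : j < s) (hij : c i = c j) :
    i = j := Nat.ModEq.eq_of_lt_of_lt (h.cycle.2.1 i j hij) hi hj

/-- Vertices `c i` and `c j` of the cycle are distinct if `i < j < i + s`. -/
theorem apply_ne (h : D.IsEar s c m p) {i j : ℕ} (hij : i < j) (hj : j < i + s) : c i ≠ c j := by
  intro heq
  have h1 := h.cycle.2.1 i j heq
  have h2 := (Nat.modEq_iff_dvd' hij.le).1 h1
  have := Nat.le_of_dvd (by omega) h2
  omega

/-- If the walk stops before `q = s - 1`, then it misses `c (j + q + 1)`, so by criticality no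
vertex branches inside it. All restrictions on starts and ends come from this. -/
theorem critical (h : D.IsEar s c m p) (hcrit : D.IsCritical) {j q : ℕ}
    (hj : D.Adj (p (m - 1)) (c j)) (hq : D.Adj (c (j + q)) (p 0)) (hqs : q < s) {w a b : V}
    (hw : w ∈ p '' Set.Iio m ∪ c '' Set.Icc j (j + q))
    (ha : a ∈ p '' Set.Iio m ∪ c '' Set.Icc j (j + q))
    (hb : b ∈ p '' Set.Iio m ∪ c '' Set.Icc j (j + q))
    (hab : a ≠ b) (hwa : D.Adj w a) (hwb : D.Adj w b) : q = s - 1 := by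
  by_contra hne
  rcases hcrit _ (strongOn_ear h.cycle.1 h.pos h.adj hj hq) w hw a ha b hb hab hwa hwb
    (c (j + q + 1)) with ⟨k, hk, hk'⟩ | ⟨i, hi, heq⟩
  · exact h.ne k hk _ hk'
  · simp only [Set.mem_Icc] at hi
    exact h.apply_ne (by omega) (by omega) heq

/-- The later of two arcs from the cycle to the ear starts just before each end of the ear. -/
theorem source_eq (h : D.IsEar s c m p) (hcrit : D.IsCritical) {j q q' : ℕ}
    (hj : D.Adj (p (m - 1)) (c j)) (hq : D.Adj (c (j + q)) (p 0)) (hq' : D.Adj (c (j + q')) (p 0))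
    (hlt : q < q') (hs : q' < s) : q' = s - 1 :=
  h.critical hcrit hj hq' hs (w := c (j + q)) (a := c (j + q + 1)) (b := p 0)
    (Or.inr ⟨_, by simp only [Set.mem_Icc]; omega, rfl⟩)
    (Or.inr ⟨_, by simp only [Set.mem_Icc]; omega, rfl⟩) (Or.inl ⟨0, h.pos, rfl⟩)
    (h.ne 0 h.pos _).symm (h.cycle.1.2.2 _) hq

/-- The earlier of two arcs from the ear to the cycle ends just after each start of the ear. -/
theorem target_eq (h : D.IsEar s c m p) (hcrit : D.IsCritical) {i a a' : ℕ}
    (hi : D.Adj (c i) (p 0)) (ha : D.Adj (p (m - 1)) (c (i + 1 + a)))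
    (ha' : D.Adj (p (m - 1)) (c (i + 1 + a'))) (hlt : a < a') (hs : a' < s) : a = 0 := by
  -- The stretch from the earlier end `c (i + 1 + a)` to `c (i + s) = c i` contains the later end,
  -- so the last ear vertex branches inside the walk.
  have := h.critical hcrit (q := s - 1 - a) ha (by
      rw [show i + 1 + a + (s - 1 - a) = i + s by omega, h.apply_add]
      exact hi) (by omega) (w := p (m - 1)) (a := c (i + 1 + a)) (b := c (i + 1 + a'))
    (Or.inl ⟨m - 1, by have := h.pos; simp only [Set.mem_Iio]; omega, rfl⟩)
    (Or.inr ⟨_, by simp only [Set.mem_Icc]; omega, rfl⟩)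
    (Or.inr ⟨_, by simp only [Set.mem_Icc]; omega, rfl⟩)
    (h.apply_ne (by omega) (by omega)) ha ha'
  omega

/-- An arc joining two vertices of the ear that does not belong to it. -/
theorem back_eq (h : D.IsEar s c m p) (hcrit : D.IsCritical) {j q k l : ℕ}
    (hj : D.Adj (p (m - 1)) (c j)) (hq : D.Adj (c (j + q)) (p 0)) (hs : q < s) (hk : k < m)
    (hl : l ≤ k) (hkl : D.Adj (p k) (p l)) : q = s - 1 := by
  have hmem : ∀ t < m, p t ∈ p '' Set.Iio m ∪ c '' Set.Icc j (j + q) :=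
    fun t ht => Or.inl ⟨t, ht, rfl⟩
  by_cases hkm : k + 1 < m
  · refine h.critical hcrit hj hq hs (hmem k hk) (hmem l (by omega)) (hmem (k + 1) hkm) ?_ hkl
      (h.adj k hkm)
    intro heq
    have := h.inj _ (by omega) _ hkm heq
    omega
  · obtain rfl : k = m - 1 := by omega
    exact h.critical hcrit hj hq hs (hmem _ hk) (hmem l (by omega))
      (Or.inr ⟨j, by simp, rfl⟩) (h.ne l (by omega) j) hkl hj

/-- The cycles formed by backward arcs of the ear are disjoint. -/
theorem back_disjoint (h : D.IsEar s c m p) (hcrit : D.IsCritical) {k l k' l' : ℕ}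
    (hk : k < m) (hl : l ≤ k) (hkl : D.Adj (p k) (p l))
    (hk' : k' < m) (hl' : l' ≤ k') (hkl' : D.Adj (p k') (p l')) (h1 : l' ≤ k) (h2 : k ≤ k') :
    k = k' ∧ l = l' := by
  have hint : ∀ k l, k < m → l ≤ k → D.Adj (p k) (p l) → D.StrongOn (p '' Set.Icc l k) := by
    intro k l hk hl hkl
    have := strongOn_image_Iic (f := fun t => p (l + t)) (d := k - l)
      (fun i hi => h.adj _ (by omega)) (by simpa [Nat.add_sub_cancel' hl] using hkl)
    convert this using 1
    ext x
    constructor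
    · rintro ⟨t, ht, rfl⟩
      simp only [Set.mem_Icc] at ht
      exact ⟨t - l, by simp only [Set.mem_Iic]; omega, by simp [Nat.add_sub_cancel' ht.1]⟩
    · rintro ⟨t, ht, rfl⟩
      simp only [Set.mem_Iic] at ht
      exact ⟨l + t, by simp only [Set.mem_Icc]; omega, rfl⟩
  have hun := (hint k l hk hl hkl).union (hint k' l' hk' hl' hkl') (z := p k)
    ⟨k, by simp [hl], rfl⟩ ⟨k, by simp [h1, h2], rfl⟩
  -- Two overlapping ear cycles have a strongly connected union that misses the cycle `c`; hence no
  -- vertex may branch in it. If the cycles differ, `p k` does.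
  have hfalse : ¬ ∀ x, x ∈ p '' Set.Icc l k ∪ p '' Set.Icc l' k' := by
    intro hall
    rcases hall (c 0) with ⟨t, ht, ht'⟩ | ⟨t, ht, ht'⟩
    · exact h.ne t (by simp only [Set.mem_Icc] at ht; omega) _ ht'
    · exact h.ne t (by simp only [Set.mem_Icc] at ht; omega) _ ht'
  by_contra hne
  rcases h2.lt_or_eq with hlt | rfl
  · refine hfalse (hcrit _ hun (p k) (Or.inl ⟨k, by simp [hl], rfl⟩) (p l)
      (Or.inl ⟨l, by simp [hl], rfl⟩) (p (k + 1))
      (Or.inr ⟨k + 1, by simp only [Set.mem_Icc]; omega, rfl⟩) ?_ hkl (h.adj _ (by omega)))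
    intro heq
    have := h.inj _ (by omega) _ (by omega) heq
    omega
  · refine hfalse (hcrit _ hun (p k) (Or.inl ⟨k, by simp [hl], rfl⟩) (p l)
      (Or.inl ⟨l, by simp [hl], rfl⟩) (p l') (Or.inr ⟨l', by simp [hl'], rfl⟩) ?_ hkl hkl')
    intro heq
    exact hne ⟨rfl, h.inj _ (by omega) _ (by omega) heq⟩

end IsEar

end Digraph

/-! ### Recognising ∞-digraphs, θ-digraphs and cycles with arcs -/

namespace Digraph

variable {V : Type*} {D : Digraph V}

/-- Two cycles of `D` that share a single vertex form an ∞-digraph. -/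
theorem hasInfinitySubdigraph_of_cycles {r s : ℕ} {f g : ℕ → V} (hr : 2 ≤ r) (hs : 2 ≤ s)
    (hf : ∀ i < r, ∀ j < r, f i = f j → i = j) (hg : ∀ i < s, ∀ j < s, g i = g j → i = j)
    (h0 : f 0 = g 0) (hfg : ∀ i < r, ∀ j < s, f i = g j → i = 0 ∧ j = 0)
    (hfa : ∀ i, i + 1 < r → D.Adj (f i) (f (i + 1))) (hfl : D.Adj (f (r - 1)) (f 0))
    (hga : ∀ i, i + 1 < s → D.Adj (g i) (g (i + 1))) (hgl : D.Adj (g (s - 1)) (g 0)) :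
    D.HasInfinitySubdigraph := by
  let S : Set V := {x | (∃ i < r, f i = x) ∨ ∃ j < s, g j = x}
  let P : Fin r → S := fun i => ⟨f i, Or.inl ⟨i, i.2, rfl⟩⟩
  let Q : Fin s → S := fun i => ⟨g i, Or.inr ⟨i, i.2, rfl⟩⟩
  have hadj : ∀ {r : ℕ} {f : ℕ → V}, (∀ i, i + 1 < r → D.Adj (f i) (f (i + 1))) →
      D.Adj (f (r - 1)) (f 0) → ∀ i j, i < r → j = (i + 1) % r → D.Adj (f i) (f j) := by
    intro r f h1 h2 i j hi hj
    by_cases h : i + 1 < r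
    · rw [Nat.mod_eq_of_lt h] at hj
      exact hj ▸ h1 i h
    · obtain rfl : i = r - 1 := by omega
      rw [Nat.sub_add_cancel (by omega), Nat.mod_self] at hj
      exact hj ▸ h2
  refine ⟨S, ⟨fun x y => IsCycleArc P x y ∨ IsCycleArc Q x y⟩, ?_, r, s, hr, hs, P, Q, ?_, ?_, ?_,
    ?_, fun _ _ => Iff.rfl⟩
  · rintro x y (⟨i, j, hij, rfl, rfl⟩ | ⟨i, j, hij, rfl, rfl⟩)
    · exact hadj hfa hfl i j i.2 hij
    · exact hadj hga hgl i j i.2 hij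
  · intro i j hij
    exact Fin.ext (hf i i.2 j j.2 (congrArg Subtype.val hij))
  · intro i j hij
    exact Fin.ext (hg i i.2 j j.2 (congrArg Subtype.val hij))
  · intro i j
    constructor
    · intro hij
      have := hfg i i.2 j j.2 (congrArg Subtype.val hij)
      exact ⟨Fin.ext this.1, Fin.ext this.2⟩
    · rintro ⟨rfl, rfl⟩
      exact Subtype.ext h0
  · rintro ⟨x, ⟨i, hi, rfl⟩ | ⟨i, hi, rfl⟩⟩
    · exact Or.inl ⟨⟨i, hi⟩, rfl⟩
    · exact Or.inr ⟨⟨i, hi⟩, rfl⟩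

/-- A labelling of the vertices by `0, …, n - 1` gives an isomorphism. -/
theorem isomorphic_cycleWithArcs {n : ℕ} {E : Set (ℕ × ℕ)} {g : ℕ → V}
    (hinj : ∀ x < n, ∀ y < n, g x = g y → x = y) (hcover : ∀ v, ∃ x < n, g x = v)
    (hadj : ∀ x < n, ∀ y < n, D.Adj (g x) (g y) ↔
      (y = x + 1 ∨ (x + 1 = n ∧ y = 0)) ∨ (x + 1, y + 1) ∈ E) :
    D.Isomorphic (cycleWithArcs n E) := by
  have hbij : Function.Bijective fun x : Fin n => g x := by
    refine ⟨fun x y hxy => Fin.ext (hinj x x.2 y y.2 hxy), fun v => ?_⟩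
    obtain ⟨x, hx, rfl⟩ := hcover v
    exact ⟨⟨x, hx⟩, rfl⟩
  refine ⟨RelIso.symm ⟨Equiv.ofBijective _ hbij, ?_⟩⟩
  intro x y
  have hx := x.2
  have hy := y.2
  have hmod : (y : ℕ) = (x + 1) % n ↔ ((y : ℕ) = x + 1 ∨ ((x : ℕ) + 1 = n ∧ (y : ℕ) = 0)) := by
    rcases (show (x : ℕ) + 1 ≤ n from hx).lt_or_eq with h | h
    · rw [Nat.mod_eq_of_lt h]; omega
    · rw [h, Nat.mod_self]; omega
  exact (hadj x hx y hy).trans (or_congr hmod.symm Iff.rfl)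

/-- Backward arcs `a → b` that span disjoint intervals can be listed in increasing order. -/
theorem exists_increasing_enumeration {n : ℕ} {G : ℕ → ℕ → Prop}
    (hG : ∀ a b, G a b → b < a ∧ a < n)
    (hdisj : ∀ a b a' b', G a b → G a' b' → a ≤ a' → b' ≤ a → a = a' ∧ b = b')
    {a₁ b₁ a₂ b₂ : ℕ} (h₁ : G a₁ b₁) (h₂ : G a₂ b₂) (hne : a₁ ≠ a₂) :
    ∃ (k : ℕ) (x y : ℕ → ℕ), 2 ≤ k ∧ 1 ≤ y 1 ∧ x k ≤ n ∧
      (∀ i ∈ Finset.Icc 1 k, y i < x i) ∧ (∀ i ∈ Finset.Ico 1 k, x i < y (i + 1)) ∧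
      ∀ a b, (a + 1, b + 1) ∈ {e : ℕ × ℕ | ∃ i ∈ Finset.Icc 1 k, e = (x i, y i)} ↔ G a b := by
  classical
  let T : Finset ℕ := (Finset.range n).filter fun a => ∃ b, G a b
  have hT : ∀ a, a ∈ T ↔ ∃ b, G a b := by
    intro a
    simp only [T, Finset.mem_filter, Finset.mem_range, and_iff_right_iff_imp]
    rintro ⟨b, hb⟩
    exact (hG a b hb).2
  have : ∀ a, ∃ b, a ∈ T → G a b := by
    intro a
    by_cases h : a ∈ T
    · obtain ⟨b, hb⟩ := (hT a).1 h
      exact ⟨b, fun _ => hb⟩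
    · exact ⟨0, fun h' => absurd h' h⟩
  choose hd hhd using this
  let φ := T.orderEmbOfFin rfl
  have hφ : ∀ i, φ i ∈ T := fun i => Finset.orderEmbOfFin_mem T rfl i
  have hcard : 2 ≤ T.card := by
    rw [← Finset.card_pair hne]
    refine Finset.card_le_card fun a ha => ?_
    simp only [Finset.mem_insert, Finset.mem_singleton] at ha
    rcases ha with rfl | rfl
    exacts [(hT _).2 ⟨_, h₁⟩, (hT _).2 ⟨_, h₂⟩]
  -- The enumeration is indexed from 1; the default 0 is never used.
  let t : ℕ → ℕ := fun i => if h : i - 1 < T.card then φ ⟨i - 1, h⟩ else 0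
  have ht : ∀ i, 1 ≤ i → i ≤ T.card → ∃ h : i - 1 < T.card, t i = φ ⟨i - 1, h⟩ := by
    intro i h1 h2
    have h : i - 1 < T.card := by omega
    exact ⟨h, by simp [t, h]⟩
  have htT : ∀ i, 1 ≤ i → i ≤ T.card → t i ∈ T := by
    intro i h1 h2
    obtain ⟨h, h3⟩ := ht i h1 h2
    rw [h3]
    exact hφ _
  refine ⟨T.card, fun i => t i + 1, fun i => hd (t i) + 1, hcard,
    Nat.le_add_left 1 _, ?_, ?_, ?_, ?_⟩
  · exact (hG _ _ (hhd _ (htT T.card (by omega) le_rfl))).2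
  · intro i hi
    rw [Finset.mem_Icc] at hi
    exact Nat.add_lt_add_right (hG _ _ (hhd _ (htT i hi.1 hi.2))).1 1
  · intro i hi
    rw [Finset.mem_Ico] at hi
    have g1 := hhd _ (htT i (by omega) (by omega))
    have g2 := hhd _ (htT (i + 1) (by omega) (by omega))
    obtain ⟨h1, e1⟩ := ht i (by omega) (by omega)
    obtain ⟨h2, e2⟩ := ht (i + 1) (by omega) (by omega)
    have hlt : t i < t (i + 1) := by
      rw [e1, e2]
      exact φ.strictMono (Fin.mk_lt_mk.2 (by omega))
    refine Nat.add_lt_add_right (?_ : t i < hd (t (i + 1))) 1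
    by_contra hcon
    have := hdisj _ _ _ _ g1 g2 hlt.le (by omega)
    omega
  · intro a b
    constructor
    · rintro ⟨i, hi, he⟩
      rw [Finset.mem_Icc] at hi
      simp only [Prod.mk.injEq, Nat.add_right_cancel_iff] at he
      rw [he.1, he.2]
      exact hhd _ (htT i hi.1 hi.2)
    · intro hab
      have haT : a ∈ T := (hT a).2 ⟨b, hab⟩
      obtain ⟨⟨i, hi⟩, hia⟩ : ∃ i, φ i = a := by
        have : a ∈ Set.range φ := by
          simpa [φ] using haT
        exact this
      have e1 : t (i + 1) = a := by
        simp only [t, Nat.add_sub_cancel, hi, dif_pos]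
        exact hia
      refine ⟨i + 1, Finset.mem_Icc.2 (by omega), ?_⟩
      -- For two arcs out of the same `a`, disjointness says that they coincide, so the chosen head
      -- is `b`.
      have := hdisj _ _ _ _ hab (hhd a haT) le_rfl (hG _ _ (hhd a haT)).1.le
      simp only [e1, ← this.2]

/-- A description of θ-digraphs that does not order the two parallel paths by length. -/
theorem isThetaDigraph_of_paths {a b d : ℕ} {f g r : ℕ → V} (hab : 0 < a ∨ 0 < b)
    (hf : ∀ i < a + 2, ∀ j < a + 2, f i = f j → i = j)
    (hg : ∀ i < b + 2, ∀ j < b + 2, g i = g j → i = j)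
    (hr : ∀ i < d + 2, ∀ j < d + 2, r i = r j → i = j)
    (h0 : f 0 = g 0) (h1 : f (a + 1) = g (b + 1)) (h2 : f 0 = r (d + 1)) (h3 : f (a + 1) = r 0)
    (hfg : ∀ i < a + 2, ∀ j < b + 2, f i = g j → (i = 0 ∧ j = 0) ∨ (i = a + 1 ∧ j = b + 1))
    (hfr : ∀ i < a + 2, ∀ j < d + 2, f i = r j → (i = 0 ∧ j = d + 1) ∨ (i = a + 1 ∧ j = 0))
    (hgr : ∀ i < b + 2, ∀ j < d + 2, g i = r j → (i = 0 ∧ j = d + 1) ∨ (i = b + 1 ∧ j = 0))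
    (hcover : ∀ x, (∃ i < a + 2, f i = x) ∨ (∃ i < b + 2, g i = x) ∨ ∃ i < d + 2, r i = x)
    (hadj : ∀ x y, D.Adj x y ↔ (∃ i < a + 1, f i = x ∧ f (i + 1) = y) ∨
      (∃ i < b + 1, g i = x ∧ g (i + 1) = y) ∨ ∃ i < d + 1, r i = x ∧ r (i + 1) = y) :
    D.IsThetaDigraph := by
  wlog hle : a ≤ b generalizing a b f g
  · refine this hab.symm hg hf h0.symm h1.symm (h0.symm.trans h2) (h1.symm.trans h3) ?_ hgr hfr ?_ ?_
      (by omega)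
    · intro i hi j hj hij
      have := hfg j hj i hi hij.symm
      omega
    · intro x
      rcases hcover x with h | h | h
      exacts [Or.inr (Or.inl h), Or.inl h, Or.inr (Or.inr h)]
    · intro x y
      rw [hadj, or_left_comm]
  have harc : ∀ {k : ℕ} {f : ℕ → V} {x y : V}, (∃ i < k + 1, f i = x ∧ f (i + 1) = y) ↔
      IsPathArc (fun i : Fin (k + 2) => f i) x y := by
    intro k f x y
    constructor
    · rintro ⟨i, hi, rfl, rfl⟩
      exact ⟨⟨i, by omega⟩, ⟨i + 1, by omega⟩, rfl, rfl, rfl⟩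
    · rintro ⟨i, j, hij, rfl, rfl⟩
      have := j.2
      exact ⟨i, by omega, rfl, by rw [← hij]⟩
  refine ⟨a, b, d, fun i => f i, fun i => g i, fun i => r i, hle, by omega,
    fun i j h => Fin.ext (hf i i.2 j j.2 h), fun i j h => Fin.ext (hg i i.2 j j.2 h),
    fun i j h => Fin.ext (hr i i.2 j j.2 h), ?_, ?_, ?_, ?_, ?_⟩
  · intro i j
    simp only [Fin.ext_iff, Fin.val_zero, Fin.val_last]
    refine ⟨hfg i i.2 j j.2, ?_⟩
    rintro (⟨e1, e2⟩ | ⟨e1, e2⟩) <;> rw [e1, e2]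
    exacts [h0, h1]
  · intro i j
    simp only [Fin.ext_iff, Fin.val_zero, Fin.val_last]
    refine ⟨hfr i i.2 j j.2, ?_⟩
    rintro (⟨e1, e2⟩ | ⟨e1, e2⟩) <;> rw [e1, e2]
    exacts [h2, h3]
  · intro i j
    simp only [Fin.ext_iff, Fin.val_zero, Fin.val_last]
    refine ⟨hgr i i.2 j j.2, ?_⟩
    rintro (⟨e1, e2⟩ | ⟨e1, e2⟩) <;> rw [e1, e2]
    exacts [h0.symm.trans h2, h1.symm.trans h3]
  · intro x
    rcases hcover x with ⟨i, hi, rfl⟩ | ⟨i, hi, rfl⟩ | ⟨i, hi, rfl⟩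
    exacts [Or.inl (Or.inl ⟨⟨i, hi⟩, rfl⟩), Or.inl (Or.inr ⟨⟨i, hi⟩, rfl⟩), Or.inr ⟨⟨i, hi⟩, rfl⟩]
  · intro x y
    rw [hadj, harc, harc, harc]

/-- The θ-subdigraph enters the argument only through this branching vertex. The second vertices of
the two parallel paths differ because `0 < b` makes that of `q` an inner vertex. -/
theorem HasThetaSubdigraph.exists_adj_adj (h : D.HasThetaSubdigraph) :
    ∃ w a b, a ≠ b ∧ D.Adj w a ∧ D.Adj w b := by
  obtain ⟨S, H, hsub, a, b, d, p, q, r, hab, hb, -, -, -, hpq, -, -, -, hadj⟩ := h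
  have h0 : p 0 = q 0 := (hpq 0 0).2 (Or.inl ⟨rfl, rfl⟩)
  refine ⟨p 0, p 1, q 1, ?_, hsub _ _ ((hadj _ _).2 (Or.inl ⟨0, 1, by simp, rfl, rfl⟩)), ?_⟩
  · intro heq
    rcases (hpq 1 1).1 (Subtype.ext heq) with h | h
    · simp at h
    · have := congrArg Fin.val h.2
      simp at this
      omega
  · rw [h0]
    exact hsub _ _ ((hadj _ _).2 (Or.inr (Or.inl ⟨0, 1, by simp, rfl, rfl⟩)))

end Digraph

/-! ### Classification by the arcs between the ear and the cycle -/

namespace Digraph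

variable {V : Type*} {D : Digraph V}

namespace IsEar

variable {s m : ℕ} {c p : ℕ → V}

/-- Otherwise the ear closes up at `c i` to a cycle that meets `c` only there. -/
theorem source_ne_target (h : D.IsEar s c m p) (hinf : ¬ D.HasInfinitySubdigraph) {i : ℕ}
    (hi : D.Adj (c i) (p 0)) : ¬ D.Adj (p (m - 1)) (c i) := by
  intro hi'
  have hm := h.pos
  refine hinf (hasInfinitySubdigraph_of_cycles (r := m + 1) (s := s)
    (f := fun t => if t = 0 then c i else p (t - 1)) (g := fun t => c (i + t))
    (by omega) h.two_le ?_ ?_ (by simp) ?_ ?_ ?_ ?_ ?_)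
  · intro x hx y hy hxy
    by_cases hx0 : x = 0 <;> by_cases hy0 : y = 0 <;> simp only [hx0, hy0, if_true, if_false] at hxy
    · omega
    · exact absurd hxy.symm (h.ne _ (by omega) _)
    · exact absurd hxy (h.ne _ (by omega) _)
    · have := h.inj _ (by omega) _ (by omega) hxy
      omega
  · intro x hx y hy hxy
    rcases lt_trichotomy x y with hlt | heq | hlt
    · exact absurd hxy (h.apply_ne (by omega) (by omega))
    · exact heq
    · exact absurd hxy.symm (h.apply_ne (by omega) (by omega))
  · intro x hx y hy hxy
    by_cases hx0 : x = 0
    · simp only [hx0, if_true] at hxy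
      refine ⟨hx0, ?_⟩
      by_contra hy0
      exact h.apply_ne (by omega) (by omega) hxy
    · simp only [hx0, if_false] at hxy
      exact absurd hxy (h.ne _ (by omega) _)
  · intro x hx
    by_cases hx0 : x = 0
    · simpa [hx0] using hi
    · have := h.adj (x - 1) (by omega)
      rw [Nat.sub_add_cancel (by omega)] at this
      simpa [hx0] using this
  · simpa [hm.ne'] using hi'
  · intro x _
    exact h.cycle.1.2.2 (i + x)
  · have := h.cycle.1.2.2 (i + (s - 1))
    rw [show i + (s - 1) + 1 = i + s by have := h.two_le; omega, h.apply_add] at this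
    simpa using this

theorem adj_cycle_iff (h : D.IsEar s c m p) {i j : ℕ} (hi : i < s) (hj : j < s) :
    D.Adj (c i) (c j) ↔ j = i + 1 ∨ (i + 1 = s ∧ j = 0) := by
  constructor
  · intro hij
    have h1 := h.cycle.2.2 i j hij
    rcases (show i + 1 ≤ s from hi).lt_or_eq with h2 | h2
    · exact Or.inl (Nat.ModEq.eq_of_lt_of_lt h1 hj h2)
    · refine Or.inr ⟨h2, ?_⟩
      rw [h2] at h1
      exact Nat.ModEq.eq_of_lt_of_lt (h1.trans (by simp [Nat.ModEq])) hj (by omega)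
  · rintro (rfl | ⟨h2, rfl⟩)
    · exact h.cycle.1.2.2 i
    · have := h.cycle.1.2.2 i
      rw [h2] at this
      rwa [← h.apply_add 0, zero_add]

theorem cover_lt (h : D.IsEar s c m p) (x : V) : (∃ i < s, x = c i) ∨ ∃ k < m, x = p k := by
  rcases h.cover x with ⟨i, rfl⟩ | hx
  · exact Or.inl ⟨i % s, Nat.mod_lt _ h.cycle.1.1, h.cycle.1.apply_eq (Nat.mod_modEq i s).symm⟩
  · exact Or.inr hx

theorem adj_ear_iff (h : D.IsEar s c m p) {k l : ℕ} (hk : k < m) (hl : l < m) :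
    D.Adj (p k) (p l) ↔ l = k + 1 ∨ (l ≤ k ∧ D.Adj (p k) (p l)) := by
  constructor
  · intro hkl
    have := h.le_succ k hk l hl hkl
    by_cases hle : l ≤ k
    · exact Or.inr ⟨hle, hkl⟩
    · exact Or.inl (by omega)
  · rintro (rfl | hkl)
    · exact h.adj k hl
    · exact hkl.2

/-- The ear, followed by the cycle, shifted by `r`, labels the vertices. -/
theorem isomorphic (h : D.IsEar s c m p) {src tgt : ℕ → Prop} {back : ℕ → ℕ → Prop}
    (hsrc : ∀ i < s, D.Adj (c i) (p 0) ↔ src i) (htgt : ∀ j < s, D.Adj (p (m - 1)) (c j) ↔ tgt j)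
    (hback : ∀ k < m, ∀ l ≤ k, D.Adj (p k) (p l) ↔ back k l) {r : ℕ} (hr : r < m + s)
    {E : Set (ℕ × ℕ)}
    (hE : ∀ x y x' y', x < m + s → y < m + s → x' < m + s → y' < m + s →
      (x' = x + r ∨ x' + (m + s) = x + r) → (y' = y + r ∨ y' + (m + s) = y + r) →
      (((x' < m ∧ y' < m ∧ (y' = x' + 1 ∨ (y' ≤ x' ∧ back x' y'))) ∨
        (x' < m ∧ m ≤ y' ∧ x' = m - 1 ∧ tgt (y' - m)) ∨
        (m ≤ x' ∧ y' < m ∧ y' = 0 ∧ src (x' - m)) ∨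
        (m ≤ x' ∧ m ≤ y' ∧ (y' = x' + 1 ∨ (x' + 1 = m + s ∧ y' = m)))) ↔
      (y = x + 1 ∨ (x + 1 = m + s ∧ y = 0)) ∨ (x + 1, y + 1) ∈ E)) :
    D.Isomorphic (cycleWithArcs (m + s) E) := by
  have hs := h.two_le
  let e : ℕ → V := fun t => if t < m then p t else c (t - m)
  -- Addition of `r` modulo `m + s`, kept piecewise linear. It moves the starting point of the
  -- Hamiltonian cycle `p 0, …, p (m - 1), c 0, …, c (s - 1)`.
  let sh : ℕ → ℕ := fun x => if x + r < m + s then x + r else x + r - (m + s)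
  have hsh : ∀ x < m + s, sh x < m + s ∧ (sh x = x + r ∨ sh x + (m + s) = x + r) := by
    intro x hx
    simp only [sh]
    split_ifs <;> omega
  have heinj : ∀ x < m + s, ∀ y < m + s, e x = e y → x = y := by
    intro x hx y hy hxy
    by_cases h1 : x < m <;> by_cases h2 : y < m <;> simp only [e, h1, h2, if_true, if_false] at hxy
    · exact h.inj _ h1 _ h2 hxy
    · exact absurd hxy (h.ne _ h1 _)
    · exact absurd hxy.symm (h.ne _ h2 _)
    · have := h.apply_inj (by omega) (by omega) hxy
      omega
  refine isomorphic_cycleWithArcs (g := fun x => e (sh x)) ?_ ?_ ?_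
  · intro x hx y hy hxy
    have h1 := hsh x hx
    have h2 := hsh y hy
    have := heinj _ h1.1 _ h2.1 hxy
    omega
  · intro v
    obtain ⟨t, ht, rfl⟩ : ∃ t < m + s, e t = v := by
      rcases h.cover_lt v with ⟨i, hi, rfl⟩ | ⟨k, hk, rfl⟩
      · exact ⟨m + i, by omega, by simp [e]⟩
      · exact ⟨k, by omega, by simp [e, hk]⟩
    by_cases hrt : r ≤ t
    · exact ⟨t - r, by omega, by simp only [sh, Nat.sub_add_cancel hrt, ht, if_true]⟩
    · refine ⟨t + (m + s) - r, by omega, ?_⟩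
      simp only [sh]
      rw [if_neg (by omega)]
      congr 1
      omega
  · intro x hx y hy
    obtain ⟨hx', hxr⟩ := hsh x hx
    obtain ⟨hy', hyr⟩ := hsh y hy
    rw [← hE x y _ _ hx hy hx' hy' hxr hyr]
    generalize sh x = x' at *
    generalize sh y = y' at *
    by_cases h1 : x' < m <;> by_cases h2 : y' < m <;>
      simp only [e, h1, h2, if_true, if_false, true_and, false_and, false_or]
    · rw [h.adj_ear_iff h1 h2]
      have h3 : ¬ m ≤ y' := by omega
      have h4 : ¬ m ≤ x' := by omega
      simp only [h3, h4, false_and, or_false]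
      refine or_congr Iff.rfl (and_congr_right fun hle => hback _ h1 _ hle)
    · have h3 : m ≤ y' := by omega
      have h4 : ¬ m ≤ x' := by omega
      simp only [h3, h4, false_and, or_false, true_and]
      rw [← htgt _ (by omega)]
      constructor
      · intro hadj
        have := h.eq_last _ h1 _ hadj
        exact ⟨this, this ▸ hadj⟩
      · rintro ⟨h5, h6⟩
        rwa [h5]
    · have h3 : ¬ m ≤ y' := by omega
      have h4 : m ≤ x' := by omega
      simp only [h3, h4, false_and, or_false, true_and]
      rw [← hsrc _ (by omega)]
      constructor
      · intro hadj
        have := h.eq_zero _ _ h2 hadj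
        exact ⟨this, this ▸ hadj⟩
      · rintro ⟨h5, h6⟩
        rwa [h5]
    · have h3 : m ≤ y' := by omega
      have h4 : m ≤ x' := by omega
      simp only [h3, h4, true_and]
      rw [h.adj_cycle_iff (by omega) (by omega)]
      clear hxr hyr hE
      grind

theorem isType3_of_sources (h : D.IsEar s c m p) {q : ℕ} (hq0 : 0 < q) (hq : q < s - 1)
    (hsrc : ∀ i < s, D.Adj (c i) (p 0) ↔ i = q ∨ i = s - 1)
    (htgt : ∀ j < s, D.Adj (p (m - 1)) (c j) ↔ j = 0)
    (hback : ∀ k < m, ∀ l ≤ k, ¬ D.Adj (p k) (p l)) : D.IsType3 := by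
  have hm := h.pos
  -- Label 1 goes to `c q`. Then `p 0` has label `s - q + 1` and `c 0` has label `s - q + 1 + m`;
  -- the extra arcs are `c q → p 0` and the closing arc `c (s - 1) → c 0`.
  refine ⟨m + s, s - q + 1, s - q + 1 + m, by omega, by omega, by omega,
    h.isomorphic hsrc htgt (back := fun _ _ => False)
      (fun k hk l hl => iff_false_intro (hback k hk l hl))
      (r := m + q) (by omega) ?_⟩
  intro x y x' y' hx hy hx' hy' hxr hyr
  simp only [Set.mem_insert_iff, Set.mem_singleton_iff, Prod.mk.injEq, and_false, or_false]
  grind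

theorem isType3_of_targets (h : D.IsEar s c m p) {a : ℕ} (ha0 : 0 < a) (ha : a < s - 1)
    (hsrc : ∀ i < s, D.Adj (c i) (p 0) ↔ i = s - 1)
    (htgt : ∀ j < s, D.Adj (p (m - 1)) (c j) ↔ j = 0 ∨ j = a)
    (hback : ∀ k < m, ∀ l ≤ k, ¬ D.Adj (p k) (p l)) : D.IsType3 := by
  have hm := h.pos
  -- Label 1 goes to `c (s - 1)`. Then `c 0` and `c a` have labels `m + 2` and `m + a + 2`, and the
  -- extra arcs are `c (s - 1) → c 0` and `p (m - 1) → c a`.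
  refine ⟨m + s, m + 2, m + a + 2, by omega, by omega, by omega,
    h.isomorphic hsrc htgt (back := fun _ _ => False)
      (fun k hk l hl => iff_false_intro (hback k hk l hl))
      (r := m + s - 1) (by omega) ?_⟩
  intro x y x' y' hx hy hx' hy' hxr hyr
  simp only [Set.mem_insert_iff, Set.mem_singleton_iff, Prod.mk.injEq, and_false, or_false]
  grind

theorem isType5_of_sources_targets (h : D.IsEar s c m p) (hm : 2 ≤ m) {q : ℕ} (hq0 : 0 < q)
    (hq : q + 1 < s - 1) (hsrc : ∀ i < s, D.Adj (c i) (p 0) ↔ i = q ∨ i = s - 1)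
    (htgt : ∀ j < s, D.Adj (p (m - 1)) (c j) ↔ j = 0 ∨ j = q + 1)
    (hback : ∀ k < m, ∀ l ≤ k, ¬ D.Adj (p k) (p l)) : D.IsType5 := by
  -- Again `c (s - 1)` has label 1 and `p 0` has label 2; the third extra arc is `c q → p 0`. The
  -- bound `3 < i` is where `2 ≤ m` matters.
  refine ⟨m + s, m + 2, m + q + 3, by omega, by omega, by omega,
    h.isomorphic hsrc htgt (back := fun _ _ => False)
      (fun k hk l hl => iff_false_intro (hback k hk l hl))
      (r := m + s - 1) (by omega) ?_⟩
  intro x y x' y' hx hy hx' hy' hxr hyr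
  simp only [Set.mem_insert_iff, Set.mem_singleton_iff, Prod.mk.injEq, and_false, or_false]
  grind

theorem isType4_of_back (h : D.IsEar s c m p) (hsimple : D.IsSimple) (hcrit : D.IsCritical)
    (hsrc : ∀ i < s, D.Adj (c i) (p 0) ↔ i = s - 1)
    (htgt : ∀ j < s, D.Adj (p (m - 1)) (c j) ↔ j = 0)
    {k l : ℕ} (hk : k < m) (hl : l ≤ k) (hkl : D.Adj (p k) (p l)) : D.IsType4 := by
  have hs := h.two_le
  -- On the Hamiltonian cycle through the ear and `c`, the closing arc of `c` is one more backward
  -- arc, disjoint from those of the ear; so there are at least two.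
  obtain ⟨N, x, y, hN, hy1, hxN, hyx, hxy, hE⟩ := exists_increasing_enumeration (n := m + s)
    (G := fun a b => (a < m ∧ b ≤ a ∧ D.Adj (p a) (p b)) ∨ (a = m + s - 1 ∧ b = m))
    (by
      rintro a b (⟨h1, h2, h3⟩ | ⟨h1, h2⟩)
      · refine ⟨lt_of_le_of_ne h2 ?_, by omega⟩
        rintro rfl
        exact hsimple _ h3
      · omega)
    (by
      rintro a b a' b' (⟨h1, h2, h3⟩ | ⟨h1, h2⟩) (⟨h1', h2', h3'⟩ | ⟨h1', h2'⟩) h4 h5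
      · exact h.back_disjoint hcrit h1 h2 h3 h1' h2' h3' h5 h4
      · omega
      · omega
      · omega)
    (Or.inl ⟨hk, hl, hkl⟩) (Or.inr ⟨rfl, rfl⟩) (by omega)
  refine ⟨m + s, N, x, y, hN, hy1, hxN, hyx, hxy,
    h.isomorphic hsrc htgt (back := fun a b => D.Adj (p a) (p b)) (fun _ _ _ _ => Iff.rfl)
      (r := 0) (by omega) ?_⟩
  intro x y x' y' hx hy hx' hy' hxr hyr
  rw [hE]
  obtain rfl : x' = x := by omega
  obtain rfl : y' = y := by omega
  clear hE hyx hxy hsrc htgt hy1 hxN hN hkl hk hl hxr hyr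
  generalize D.Adj (p x') (p y') = A
  grind

theorem isThetaDigraph (h : D.IsEar s c m p) {q : ℕ} (hq0 : 0 < q) (hq : q < s)
    (hsrc : ∀ i < s, D.Adj (c i) (p 0) ↔ i = q)
    (htgt : ∀ j < s, D.Adj (p (m - 1)) (c j) ↔ j = 0)
    (hback : ∀ k < m, ∀ l ≤ k, ¬ D.Adj (p k) (p l)) : D.IsThetaDigraph := by
  have hm := h.pos
  have hcs : c s = c 0 := by simpa using h.apply_add 0
  let f : ℕ → V := fun t => if t = 0 then c q else if t = m + 1 then c 0 else p (t - 1)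
  have hf : ∀ t, t < m + 2 → (t = 0 ∧ f t = c q) ∨ (t = m + 1 ∧ f t = c 0) ∨
      (0 < t ∧ t < m + 1 ∧ f t = p (t - 1)) := by
    intro t ht
    by_cases h0 : t = 0
    · simp [f, h0]
    · by_cases h1 : t = m + 1
      · simp [f, h1]
      · exact Or.inr (Or.inr ⟨by omega, by omega, by simp [f, h0, h1]⟩)
  have hc : ∀ i j, i < s → j ≤ s → c i = c j → i = j ∨ (i = 0 ∧ j = s) := by
    intro i j hi hj hij
    rcases hj.lt_or_eq with h1 | rfl
    · exact Or.inl (h.apply_inj hi h1 hij)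
    · rw [hcs] at hij
      exact Or.inr ⟨h.apply_inj hi (by omega) hij, rfl⟩
  -- The branching vertex is `c q` and the paths rejoin at `c 0`: one runs through the ear, one
  -- along the cycle to `c s = c 0`, and the return path is `c 0, …, c q`.
  refine isThetaDigraph_of_paths (a := m) (b := s - q - 1) (d := q - 1) (f := f)
    (g := fun t => c (q + t)) (r := c) (Or.inl hm) ?_ ?_ ?_ ?_ ?_ ?_ ?_ ?_ ?_ ?_ ?_ ?_
  · intro i hi j hj hij
    rcases hf i hi with ⟨h1, h2⟩ | ⟨h1, h2⟩ | ⟨h1, h1', h2⟩ <;>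
      rcases hf j hj with ⟨h3, h4⟩ | ⟨h3, h4⟩ | ⟨h3, h3', h4⟩ <;> rw [h2, h4] at hij
    · omega
    · have := h.apply_inj (by omega) (by omega) hij
      omega
    · exact absurd hij.symm (h.ne _ (by omega) _)
    · have := h.apply_inj (by omega) (by omega) hij
      omega
    · omega
    · exact absurd hij.symm (h.ne _ (by omega) _)
    · exact absurd hij (h.ne _ (by omega) _)
    · exact absurd hij (h.ne _ (by omega) _)
    · have := h.inj _ (by omega) _ (by omega) hij
      omega
  · intro i hi j hj hij
    rcases lt_trichotomy i j with hlt | heq | hlt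
    · exact absurd hij (h.apply_ne (by omega) (by omega))
    · exact heq
    · exact absurd hij.symm (h.apply_ne (by omega) (by omega))
  · intro i hi j hj hij
    exact h.apply_inj (by omega) (by omega) hij
  · simp [f]
  · simp [f, show q + (s - q - 1 + 1) = s by omega, hcs]
  · simp [f, Nat.sub_add_cancel hq0]
  · simp [f]
  · intro i hi j hj hij
    rcases hf i hi with ⟨h1, h2⟩ | ⟨h1, h2⟩ | ⟨h1, h1', h2⟩ <;> rw [h2] at hij
    · have := hc _ _ hq (by omega) hij
      omega
    · have := hc _ _ (by omega) (by omega) hij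
      omega
    · exact absurd hij (h.ne _ (by omega) _)
  · intro i hi j hj hij
    rcases hf i hi with ⟨h1, h2⟩ | ⟨h1, h2⟩ | ⟨h1, h1', h2⟩ <;> rw [h2] at hij
    · have := h.apply_inj hq (by omega) hij
      omega
    · have := h.apply_inj (by omega) (by omega) hij
      omega
    · exact absurd hij (h.ne _ (by omega) _)
  · intro i hi j hj hij
    have := hc _ _ (by omega) (by omega) hij.symm
    omega
  · intro x
    rcases h.cover_lt x with ⟨i, hi, rfl⟩ | ⟨k, hk, rfl⟩
    · by_cases hiq : i ≤ q
      · exact Or.inr (Or.inr ⟨i, by omega, rfl⟩)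
      · exact Or.inr (Or.inl ⟨i - q, by omega, by simp [show q + (i - q) = i by omega]⟩)
    · exact Or.inl ⟨k + 1, by omega, by simp [f, show k ≠ m by omega]⟩
  · intro x y
    constructor
    · intro hxy
      rcases h.cover_lt x with ⟨i, hi, rfl⟩ | ⟨k, hk, rfl⟩ <;>
        rcases h.cover_lt y with ⟨j, hj, rfl⟩ | ⟨l, hl, rfl⟩
      · right
        by_cases hiq : i < q
        · refine Or.inr ⟨i, by omega, rfl, ?_⟩
          rcases (h.adj_cycle_iff hi hj).1 hxy with h1 | h1
          · rw [h1]
          · omega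
        · refine Or.inl ⟨i - q, by omega, by simp [show q + (i - q) = i by omega], ?_⟩
          rw [show q + (i - q + 1) = i + 1 by omega]
          rcases (h.adj_cycle_iff hi hj).1 hxy with h1 | ⟨h1, h2⟩
          · rw [h1]
          · rw [h1, h2, hcs]
      · have h1 := h.eq_zero _ _ hl hxy
        subst h1
        have h2 := (hsrc i hi).1 hxy
        exact Or.inl ⟨0, by omega, by simp [f, h2], by simp [f, hm.ne']⟩
      · have h1 := h.eq_last _ hk _ hxy
        subst h1
        have h2 := (htgt j hj).1 hxy
        refine Or.inl ⟨m, by omega, by simp [f, hm.ne'], by simp [f, h2]⟩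
      · rcases (h.adj_ear_iff hk hl).1 hxy with h1 | h1
        · exact Or.inl ⟨k + 1, by omega, by simp [f, show k ≠ m by omega],
            by simp [f, h1, show k + 1 ≠ m by omega]⟩
        · exact absurd h1.2 (hback k hk l h1.1)
    · rintro (⟨i, hi, rfl, rfl⟩ | ⟨i, hi, rfl, rfl⟩ | ⟨i, hi, rfl, rfl⟩)
      · rcases hf i (by omega) with ⟨h1, h2⟩ | ⟨h1, h2⟩ | ⟨h1, h1', h2⟩
        · subst h1
          simpa [f, hm.ne'] using (hsrc q hq).2 rfl
        · omega
        · rw [h2]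
          by_cases him : i = m
          · subst him
            simpa [f] using (htgt 0 (by omega)).2 rfl
          · have := h.adj (i - 1) (by omega)
            rw [Nat.sub_add_cancel h1] at this
            simpa [f, him] using this
      · exact h.cycle.1.2.2 (q + i)
      · exact h.cycle.1.2.2 i

/-- If there are two arcs from the cycle to the ear and two arcs back, then the ear has at least
two inner vertices. -/
theorem two_le_of_sources_targets (h : D.IsEar s c m p) (hinf : ¬ D.HasInfinitySubdigraph) {q : ℕ}
    (hq : q < s - 1) (hsrc : D.Adj (c q) (p 0)) (hsrcLast : D.Adj (c (s - 1)) (p 0))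
    (htgt : D.Adj (p (m - 1)) (c 0)) (htgt' : D.Adj (p (m - 1)) (c (q + 1))) : 2 ≤ m := by
  by_contra hlt
  obtain rfl : m = 1 := by have := h.pos; omega
  have hp := h.ne 0 one_pos
  -- With a single ear vertex, the cycles `p 0, c 0, …, c q` and `p 0, c (q + 1), …, c (s - 1)`
  -- share only `p 0`.
  refine hinf (hasInfinitySubdigraph_of_cycles (r := q + 2) (s := s - q)
    (f := fun t => if t = 0 then p 0 else c (t - 1))
    (g := fun t => if t = 0 then p 0 else c (q + t)) (by omega) (by omega) ?_ ?_ (by simp)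
    ?_ ?_ ?_ ?_ ?_)
  · intro x hx y hy hxy
    by_cases hx0 : x = 0 <;> by_cases hy0 : y = 0 <;> simp only [hx0, hy0, if_true, if_false] at hxy
    · omega
    · exact absurd hxy (hp _)
    · exact absurd hxy.symm (hp _)
    · have := h.apply_inj (by omega) (by omega) hxy
      omega
  · intro x hx y hy hxy
    by_cases hx0 : x = 0 <;> by_cases hy0 : y = 0 <;> simp only [hx0, hy0, if_true, if_false] at hxy
    · omega
    · exact absurd hxy (hp _)
    · exact absurd hxy.symm (hp _)
    · have := h.apply_inj (by omega) (by omega) hxy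
      omega
  · intro x hx y hy hxy
    by_cases hx0 : x = 0 <;> by_cases hy0 : y = 0 <;> simp only [hx0, hy0, if_true, if_false] at hxy
    · omega
    · exact absurd hxy (hp _)
    · exact absurd hxy.symm (hp _)
    · have := h.apply_inj (by omega) (by omega) hxy
      omega
  · intro x hx
    by_cases hx0 : x = 0
    · simpa [hx0] using htgt
    · have := h.cycle.1.2.2 (x - 1)
      rw [Nat.sub_add_cancel (by omega)] at this
      simpa [hx0] using this
  · simpa using hsrc
  · intro x hx
    by_cases hx0 : x = 0
    · simpa [hx0] using htgt'
    · simpa [hx0, ← add_assoc] using h.cycle.1.2.2 (q + x)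
  · simpa [show s - q - 1 ≠ 0 by omega, show q + (s - q - 1) = s - 1 by omega] using hsrcLast

/-- The case of two arcs from the cycle to the ear. -/
theorem classification_of_two_sources (h : D.IsEar s c m p) (hcrit : D.IsCritical)
    (hinf : ¬ D.HasInfinitySubdigraph) (h0 : D.Adj (p (m - 1)) (c 0)) {q q' : ℕ} (hqq' : q < q')
    (hq' : q' < s) (hq : D.Adj (c q) (p 0)) (hqs : D.Adj (c q') (p 0)) :
    D.IsType3 ∨ D.IsType5 := by
  have hpair : ∀ {a b : ℕ}, a < b → b < s → D.Adj (c a) (p 0) → D.Adj (c b) (p 0) → b = s - 1 :=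
    fun hab hb h1 h2 => h.source_eq hcrit h0 (by simpa using h1) (by simpa using h2) hab hb
  obtain rfl := hpair hqq' hq' hq hqs
  have hsrc : ∀ i < s, D.Adj (c i) (p 0) ↔ i = q ∨ i = s - 1 := by
    intro i hi
    constructor
    · intro hadj
      rcases lt_trichotomy i q with hlt | heq | hlt
      · have := hpair hlt (by omega) hadj hq
        omega
      · exact Or.inl heq
      · exact Or.inr (hpair hlt hi hq hadj)
    · rintro (rfl | rfl) <;> assumption
  have hback : ∀ k < m, ∀ l ≤ k, ¬ D.Adj (p k) (p l) := by
    intro k hk l hl hkl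
    have := h.back_eq hcrit h0 (q := q) (by simpa using hq) (by omega) hk hl hkl
    omega
  have hq0 : 0 < q := by
    rcases Nat.eq_zero_or_pos q with rfl | hpos
    · exact absurd h0 (h.source_ne_target hinf hq)
    · exact hpos
  -- Seen from an end before `c q`, the later start `c (s - 1)` would not lie just before that end.
  -- An end beyond `c (q + 1)` would be the first one after `c q` without following it directly.
  have htgt : ∀ j < s, D.Adj (p (m - 1)) (c j) → j = 0 ∨ j = q + 1 := by
    intro j hj hadj
    by_contra hne
    rcases lt_trichotomy j q with hlt | rfl | hlt
    · have := h.source_eq hcrit hadj (q := q - j) (q' := s - 1 - j)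
        (by rwa [Nat.add_sub_cancel' hlt.le]) (by rwa [Nat.add_sub_cancel' (by omega)])
        (by omega) (by omega)
      omega
    · exact h.source_ne_target hinf hq hadj
    · have := h.target_eq hcrit hq (a := j - q - 1) (a' := s - q - 1)
        (by rwa [show q + 1 + (j - q - 1) = j by omega])
        (by
          rw [show q + 1 + (s - q - 1) = 0 + s by omega, h.apply_add]
          exact h0) (by omega) (by omega)
      omega
  by_cases hT : D.Adj (p (m - 1)) (c (q + 1))
  · right
    have hne : q + 1 ≠ s - 1 := fun heq => h.source_ne_target hinf hqs (heq ▸ hT)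
    refine h.isType5_of_sources_targets (h.two_le_of_sources_targets hinf hqq' hq hqs h0 hT) hq0
      (by omega) hsrc (fun j hj => ⟨htgt j hj, ?_⟩) hback
    rintro (rfl | rfl) <;> assumption
  · left
    refine h.isType3_of_sources hq0 hqq' hsrc (fun j hj => ⟨fun hadj => ?_, ?_⟩) hback
    · rcases htgt j hj hadj with h1 | rfl
      exacts [h1, absurd hadj hT]
    · rintro rfl
      exact h0

/-- The case of a single arc from the cycle to the ear, which starts just before an end of the
ear, and a further arc from the ear to the cycle. -/
theorem isType3_of_two_targets (h : D.IsEar s c m p) (hcrit : D.IsCritical)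
    (hinf : ¬ D.HasInfinitySubdigraph) (h0 : D.Adj (p (m - 1)) (c 0))
    (hsrc : ∀ i < s, D.Adj (c i) (p 0) ↔ i = s - 1) {a : ℕ} (ha0 : 0 < a) (ha : a < s)
    (hadj : D.Adj (p (m - 1)) (c a)) : D.IsType3 := by
  have hs : D.Adj (c (s - 1)) (p 0) := (hsrc (s - 1) (by omega)).2 rfl
  have hne : a ≠ s - 1 := by
    rintro rfl
    exact h.source_ne_target hinf hs hadj
  have hpair : ∀ {b b' : ℕ}, b < b' → b' < s → D.Adj (p (m - 1)) (c b) → D.Adj (p (m - 1)) (c b') →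
      b = 0 := by
    intro b b' hlt hb' h1 h2
    refine h.target_eq hcrit hs ?_ ?_ hlt hb'
    · rwa [show s - 1 + 1 + b = b + s by omega, h.apply_add]
    · rwa [show s - 1 + 1 + b' = b' + s by omega, h.apply_add]
  refine h.isType3_of_targets ha0 (by omega) hsrc (fun j hj => ⟨fun hj' => ?_, ?_⟩) ?_
  · rcases lt_trichotomy j a with hlt | heq | hlt
    · exact Or.inl (hpair hlt ha hj' hadj)
    · exact Or.inr heq
    · have := hpair hlt hj hadj hj'
      omega
  · rintro (rfl | rfl) <;> assumption
  · intro k hk l hl hkl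
    have := h.back_eq hcrit hadj (q := s - 1 - a) (by rwa [Nat.add_sub_cancel' (by omega)])
      (by omega) hk hl hkl
    omega

theorem classification (h : D.IsEar s c m p) (hsimple : D.IsSimple) (hcrit : D.IsCritical)
    (hinf : ¬ D.HasInfinitySubdigraph) :
    D.IsThetaDigraph ∨ D.IsType3 ∨ D.IsType4 ∨ D.IsType5 := by
  obtain ⟨j₀, hj₀⟩ := h.target
  wlog hj : j₀ = 0 generalizing c j₀
  · exact this (h.rotate j₀) 0 (by simpa using hj₀) rfl
  subst hj
  obtain ⟨i₀, hi₀⟩ := h.source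
  have hs := h.two_le
  obtain ⟨q, hqs, hq⟩ : ∃ q < s, D.Adj (c q) (p 0) :=
    ⟨i₀ % s, Nat.mod_lt _ (by omega), by rwa [h.cycle.1.apply_eq (Nat.mod_modEq i₀ s)]⟩
  by_cases hsrc : ∀ i < s, D.Adj (c i) (p 0) → i = q
  swap
  · push Not at hsrc
    obtain ⟨i, hi, hadj, hne⟩ := hsrc
    have : D.IsType3 ∨ D.IsType5 := by
      rcases lt_or_gt_of_ne hne with hlt | hlt
      · exact h.classification_of_two_sources hcrit hinf hj₀ hlt hqs hadj hq
      · exact h.classification_of_two_sources hcrit hinf hj₀ hlt hi hq hadj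
    tauto
  have hsrc' : ∀ i < s, D.Adj (c i) (p 0) ↔ i = q :=
    fun i hi => ⟨hsrc i hi, by rintro rfl; exact hq⟩
  have hq0 : 0 < q := by
    rcases Nat.eq_zero_or_pos q with rfl | hpos
    · exact absurd hj₀ (h.source_ne_target hinf hq)
    · exact hpos
  by_cases htgt : ∀ j < s, D.Adj (p (m - 1)) (c j) → j = 0
  · have htgt' : ∀ j < s, D.Adj (p (m - 1)) (c j) ↔ j = 0 :=
      fun j hj => ⟨htgt j hj, by rintro rfl; exact hj₀⟩
    by_cases hback : ∀ k < m, ∀ l ≤ k, ¬ D.Adj (p k) (p l)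
    · exact Or.inl (h.isThetaDigraph hq0 hqs hsrc' htgt' hback)
    · push Not at hback
      obtain ⟨k, hk, l, hl, hkl⟩ := hback
      obtain rfl := h.back_eq hcrit hj₀ (q := q) (by simpa using hq) hqs hk hl hkl
      exact Or.inr (Or.inr (Or.inl (h.isType4_of_back hsimple hcrit hsrc' htgt' hk hl hkl)))
  · push Not at htgt
    obtain ⟨a, ha, hadj, ha0⟩ := htgt
    right; left
    by_cases hq1 : q = s - 1
    · subst hq1
      exact h.isType3_of_two_targets hcrit hinf hj₀ hsrc' (by omega) ha hadj
    -- Of the two ends `c 0` and `c a`, the first one after the start `c q` must follow it directly.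
    -- It is not `c 0`, as `q ≠ s - 1`. Rotating by `a` then reduces to the case in which the start
    -- is `c (s - 1)`.
    have haq : a = q + 1 := by
      by_contra hne
      rcases lt_trichotomy a q with hlt | rfl | hlt
      · have := h.target_eq hcrit hq (a := s - q - 1) (a' := a + s - q - 1)
          (by
            rw [show q + 1 + (s - q - 1) = 0 + s by omega, h.apply_add]
            exact hj₀)
          (by rwa [show q + 1 + (a + s - q - 1) = a + s by omega, h.apply_add])
          (by omega) (by omega)
        omega
      · exact h.source_ne_target hinf hq hadj
      · have := h.target_eq hcrit hq (a := a - q - 1) (a' := s - q - 1)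
          (by rwa [show q + 1 + (a - q - 1) = a by omega])
          (by
            rw [show q + 1 + (s - q - 1) = 0 + s by omega, h.apply_add]
            exact hj₀) (by omega) (by omega)
        omega
    refine (h.rotate a).isType3_of_two_targets hcrit hinf (by simpa using hadj) ?_ (a := s - a)
      (by omega) (by omega) ?_
    · intro i hi
      by_cases hlt : i + a < s
      · rw [hsrc' _ hlt]
        omega
      · rw [show i + a = i + a - s + s by omega, h.apply_add, hsrc' _ (by omega)]
        omega
    · rw [show s - a + a = 0 + s by omega, h.apply_add]
      exact hj₀

end IsEar

end Digraph

theorem mainTheorem3 {V : Type*} [Fintype V] (D : Digraph V)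
    (hsimple : D.IsSimple) (hconn : D.StronglyConnected)
    (hthree : D.complementaritySpectrum.ncard = 3)
    (htheta : D.HasThetaSubdigraph) (hinf : ¬ D.HasInfinitySubdigraph) :
    D.IsThetaDigraph ∨ D.IsType3 ∨ D.IsType4 ∨ D.IsType5 := by
  obtain ⟨w, a, b, hab, hwa, hwb⟩ := htheta.exists_adj_adj
  have : Nonempty V := ⟨w⟩
  have hout : ∀ x, ∃ y, D.Adj x y := by
    intro x
    by_cases hx : x = w
    · exact ⟨a, hx ▸ hwa⟩
    · rcases (hconn x w).cases_head with h | ⟨y, hy, -⟩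
      exacts [absurd h hx, ⟨y, hy⟩]
  obtain ⟨s, c, hc⟩ := D.exists_isInducedCycle hout
  have hcrit : D.IsCritical := by
    intro S hS w hw a ha b hb hab hwa hwb x
    rw [hS.eq_univ_of_ncard_eq_three hsimple hconn hthree hc hw ha hb hab hwa hwb]
    trivial
  -- No vertex branches within an induced cycle, so `w`, `a`, `b` cannot all lie on `c`.
  obtain ⟨z, hz⟩ : ∃ z, z ∉ Set.range c := by
    by_contra! hall
    obtain ⟨i, rfl⟩ := hall w
    obtain ⟨j, rfl⟩ := hall a
    obtain ⟨k, rfl⟩ := hall b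
    exact hab (hc.1.apply_eq ((hc.2.2 _ _ hwa).trans (hc.2.2 _ _ hwb).symm))
  obtain ⟨m, p, hp⟩ := Digraph.exists_isEar hsimple hconn hcrit hc hz
  exact hp.classification hsimple hcrit hinf
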